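/- Let $\mathbf H^k$ be the real space of Hermitian $k\times k$ matrices, let $\Phi,\Psi\in\mathbf H^2$ with $\det\Phi<0$, and put $q_\Theta(\mu,\nu)=(\mu,\nu)^H\,\Theta\,(\mu,\nu)$ (with $(\mu,\nu)$ a column vector) and $$\mathcal C=\{(\mu,\nu)\in\mathbf C^2 : (\mu,\nu)\ne 0,\ q_\Phi(\mu,\nu)=0,\ q_\Psi(\mu,\nu)\le 0\}.$$ Assume that the subset of the closed complex plane represented by $\mathcal C$ (in homogeneous coordinates, $(\mu,\nu)\leftrightarrow\mu/\nu$) is one-dimensional, i.e. neither empty nor a singleton. **(A) Conjugate and duality.** Let $F,G\in\mathbf C^{p\times n}$ with $\operatorname{rank}(\mu G-\nu F)=p$ for all $(\mu,\nu)\neq 0$, let $E$ be a complex matrix with $n$ columns, $\mathcal A=\{a\in\mathbf C^n : (\mu G-\nu F)a=0 \text{ for some } (\mu,\nu)\in\mathcal C\}$, and let $g:\mathbf H^n\to[0,\infty]$ be the gauge $g(X)=\inf\{t\ge 0: X\in t\,\mathrm{conv}\,C\}$ of the convex hull of $C=\{aa^H : a\in\mathcal A,\ \|Ea\|\le 1\}$.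 Then $g(X)=\operatorname{tr}(EXE^H)$ if $$X\succeq 0,\qquad \Phi_{11}FXF^H+\Phi_{21}FXG^H+\Phi_{12}GXF^H+\Phi_{22}GXG^H=0,\qquad \Psi_{11}FXF^H+\Psi_{21}FXG^H+\Psi_{12}GXF^H+\Psi_{22}GXG^H\preceq 0,$$ and $g(X)=+\infty$ otherwise. 1. Let $g^*(Z)=\sup_{X\in\mathbf H^n}(\operatorname{tr}(XZ)-g(X))$. For every $Z\in\mathbf H^n$ the following are equivalent: (i) $g^*(Z)=0$; (ii) there are $P,Q\in\mathbf H^p$ with $$Q\succeq 0,\qquad Z-\begin{bmatrix}F\\G\end{bmatrix}^H(\Phi\otimes P+\Psi\otimes Q)\begin{bmatrix}F\\G\end{bmatrix}\preceq E^HE;\tag{LMI}$$ (iii) $a^HZa\le\|Ea\|^2$ for all $a\in\mathcal A$. If these fail, $g^*(Z)=+\infty$. If the inequality $q_\Psi\le 0$ is redundant in the definition of $\mathcal C$, then (ii) is equivalent to the same condition with $\Psi$ replaced by $0$. 2. Let $f:\mathbf H^n\to\mathbf R$ be any function and $f^*(Z)=\sup_X(\operatorname{tr}(XZ)-f(X))$.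 The problem of minimizing $f(X)+\sum_{k=1}^r\|Ea_k\|^2$ over $X=\sum_{k=1}^r a_ka_k^H$, $a_k\in\mathcal A$, $r\ge 0$, has the same optimal value as the problem of minimizing $f(X)+g(X)$ over $X\in\mathbf H^n$. The dual problem, to maximize $-f^*(Z)-g^*(-Z)$ over $Z\in\mathbf H^n$, has the same optimal value as maximizing $-f^*(Z)$ over all $Z,P,Q$ such that $P,Q$ satisfy (LMI) with $-Z$ in place of $Z$, and as maximizing $-f^*(Z)$ over all $Z$ with $\|Ea\|^2+a^HZa\ge 0$ for all $a\in\mathcal A$. The dual optimal value is at most the primal one. If the two are equal, $X=\sum_{k=1}^r a_ka_k^H$ with $a_k\in\mathcal A$ is primal optimal, and $Z$ is optimal for the last form of the dual, then $$f(X)+f^*(Z)=\operatorname{tr}(XZ),\qquad \|Ea_k\|^2+a_k^HZa_k=0,\quad k=1,\dots,r.$$ **(B) Generalized Kalman–Yakubovich–Popov lemma.** Let $A\in\mathbf C^{s\times s}$, $B\in\mathbf C^{s\times m}$ with $(A,B)$ controllable, i.e. $\operatorname{rank}[B,AB,\dots,A^{s-1}B]=s$, and suppose that $A$ has no eigenvalue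 $\lambda$ with $(\lambda,1)\in\mathcal C$. Put $F=[A\ B]$, $G=[I\ 0]$, $n=s+m$, let $E$ be a complex matrix with $s+m$ columns, and $M=E^HE$. Then $\operatorname{rank}(\mu G-\nu F)=s$ for all $(\mu,\nu)\ne 0$, and for every $Z\in\mathbf H^{s+m}$ the following are equivalent: there are $P,Q\in\mathbf H^s$ satisfying (LMI) with $-Z$ in place of $Z$; $\|Ea\|^2+a^HZa\ge 0$ for all $a\in\mathcal A$; and $$\begin{bmatrix}(\lambda I-A)^{-1}B\\ I\end{bmatrix}^H(M+Z)\begin{bmatrix}(\lambda I-A)^{-1}B\\ I\end{bmatrix}\succeq 0\quad\text{for all }(\lambda,1)\in\mathcal C,$$ together with $M_{22}+Z_{22}\succeq 0$ if $(1,0)\in\mathcal C$. Consequently, for every $f:\mathbf H^{s+m}\to\mathbf R$, the optimal value of the dual problem in (A.2) is that of maximizing $-f^*(Z)$ subject to these last constraints. -/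

import Mathlib

open scoped Matrix Kronecker ComplexOrder

namespace SymGauge

noncomputable section

/-- The real vector space of Hermitian matrices with rows and columns indexed by `n`. -/
abbrev Herm (n : Type*) : Type _ := selfAdjoint (Matrix n n ℂ)

/-- The real number `q_Θ(μ, ν) = (μ, ν)ᴴ Θ (μ, ν)`. -/
def quadForm (Θ : Herm (Fin 2)) (μ ν : ℂ) : ℝ :=
  (star ![μ, ν] ⬝ᵥ ((Θ : Matrix (Fin 2) (Fin 2) ℂ) *ᵥ ![μ, ν])).re

/-- The set `𝒞` of pairs `(μ, ν) ≠ 0` with `q_Φ(μ, ν) = 0` and `q_Ψ(μ, ν) ≤ 0`: a subset of a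
line or circle in the closed complex plane, in homogeneous coordinates. -/
def curve (Φ Ψ : Herm (Fin 2)) : Set (ℂ × ℂ) :=
  {x | x ≠ 0 ∧ quadForm Φ x.1 x.2 = 0 ∧ quadForm Ψ x.1 x.2 ≤ 0}

/-- The subset of the closed complex plane represented by `𝒞` is neither empty nor a singleton:
two elements of `𝒞` are not proportional, that is, they represent different points. -/
def IsOneDimensional (Φ Ψ : Herm (Fin 2)) : Prop :=
  ∃ x ∈ curve Φ Ψ, ∃ y ∈ curve Φ Ψ, x.1 * y.2 ≠ x.2 * y.1

section pencil

variable {p n q : Type*} [Fintype p] [Fintype n] [Fintype q]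

/-- The set `𝒜` of vectors `a` with `(μ G - ν F) a = 0` for some `(μ, ν) ∈ 𝒞`. -/
def dict (Φ Ψ : Herm (Fin 2)) (F G : Matrix p n ℂ) : Set (n → ℂ) :=
  {a | ∃ x ∈ curve Φ Ψ, (x.1 • G - x.2 • F) *ᵥ a = 0}

/-- The pencil has full row rank at every point of the closed complex plane. -/
def FullRowRank (F G : Matrix p n ℂ) : Prop :=
  ∀ μ ν : ℂ, (μ, ν) ≠ (0, 0) → (μ • G - ν • F).rank = Fintype.card p

/-- The Hermitian rank-one matrix `a aᴴ`. -/
def dyad (a : n → ℂ) : Herm n :=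
  ⟨Matrix.vecMulVec a (star a), by
    rw [selfAdjoint.mem_iff, Matrix.star_eq_conjTranspose, Matrix.conjTranspose_vecMulVec,
      star_star]⟩

/-- The squared Euclidean norm `‖E a‖²`. -/
def normSqE (E : Matrix q n ℂ) (a : n → ℂ) : ℝ := ‖WithLp.toLp 2 (E *ᵥ a)‖ ^ 2

/-- The real number `aᴴ Z a`. -/
def herForm (Z : Herm n) (a : n → ℂ) : ℝ := (star a ⬝ᵥ ((Z : Matrix n n ℂ) *ᵥ a)).re

/-- The real number `tr (X Z)`, the inner product of two Hermitian matrices. -/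
def trInner (X Z : Herm n) : ℝ := ((X : Matrix n n ℂ) * (Z : Matrix n n ℂ)).trace.re

/-- The Minkowski gauge `x ↦ inf {t ≥ 0 | x ∈ t C}`, with value `+∞` when there is no such `t`. -/
def minkowskiGauge {V : Type*} [AddCommGroup V] [Module ℝ V] (C : Set V) (x : V) : EReal :=
  ⨅ (t : ℝ) (_ : 0 ≤ t ∧ ∃ y ∈ C, x = t • y), (t : EReal)

/-- The set of matrices `a aᴴ` with `a ∈ 𝒜` and `‖E a‖ ≤ 1`. -/
def atoms (Φ Ψ : Herm (Fin 2)) (F G : Matrix p n ℂ) (E : Matrix q n ℂ) : Set (Herm n) :=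
  {X | ∃ a ∈ dict Φ Ψ F G, ‖WithLp.toLp 2 (E *ᵥ a)‖ ≤ 1 ∧ X = dyad a}

/-- The symmetric matrix gauge `g`: the gauge of the convex hull of the atoms. -/
def symGauge (Φ Ψ : Herm (Fin 2)) (F G : Matrix p n ℂ) (E : Matrix q n ℂ) : Herm n → EReal :=
  minkowskiGauge (convexHull ℝ (atoms Φ Ψ F G E))

/-- `Θ₁₁ F X Fᴴ + Θ₂₁ F X Gᴴ + Θ₁₂ G X Fᴴ + Θ₂₂ G X Gᴴ`. -/
def pencilMap (Θ : Herm (Fin 2)) (F G : Matrix p n ℂ) (X : Herm n) : Matrix p p ℂ :=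
  let T : Matrix (Fin 2) (Fin 2) ℂ := Θ
  let Y : Matrix n n ℂ := X
  T 0 0 • (F * Y * Fᴴ) + T 1 0 • (F * Y * Gᴴ) + T 0 1 • (G * Y * Fᴴ) + T 1 1 • (G * Y * Gᴴ)

/-- The semidefinite constraints on `X`. -/
def PrimalFeasible (Φ Ψ : Herm (Fin 2)) (F G : Matrix p n ℂ) (X : Herm n) : Prop :=
  (X : Matrix n n ℂ).PosSemidef ∧ pencilMap Φ F G X = 0 ∧ (-pencilMap Ψ F G X).PosSemidef

/-- The convex conjugate `h*(Z) = sup_X (tr (X Z) - h(X))`, over all Hermitian `X`. -/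
def conjugate (h : Herm n → EReal) (Z : Herm n) : EReal :=
  ⨆ X : Herm n, ((trInner X Z : ℝ) : EReal) - h X

/-- The stacked matrix with block rows `F` and `G`. -/
def stack (F G : Matrix p n ℂ) : Matrix (Fin 2 × p) n ℂ :=
  Matrix.of fun i j => ![F i.2 j, G i.2 j] i.1

/-- The matrices `P`, `Q` satisfy `Q ⪰ 0` and
`Z - [F; G]ᴴ (Φ ⊗ P + Ψ ⊗ Q) [F; G] ⪯ Eᴴ E`. -/
def IsCertificate (Φ Ψ : Herm (Fin 2)) (F G : Matrix p n ℂ) (E : Matrix q n ℂ)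
    (Z : Herm n) (P Q : Herm p) : Prop :=
  (Q : Matrix p p ℂ).PosSemidef ∧
    (Eᴴ * E - ((Z : Matrix n n ℂ) - (stack F G)ᴴ *
      ((Φ : Matrix (Fin 2) (Fin 2) ℂ) ⊗ₖ (P : Matrix p p ℂ) +
        (Ψ : Matrix (Fin 2) (Fin 2) ℂ) ⊗ₖ (Q : Matrix p p ℂ)) * stack F G)).PosSemidef

/-- The linear matrix inequality is feasible at `Z`. -/
def LMIFeasible (Φ Ψ : Herm (Fin 2)) (F G : Matrix p n ℂ) (E : Matrix q n ℂ)
    (Z : Herm n) : Prop :=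
  ∃ P Q : Herm p, IsCertificate Φ Ψ F G E Z P Q

/-- `aᴴ Z a ≤ ‖E a‖²` for all `a ∈ 𝒜`. -/
def BoundedOnDict (Φ Ψ : Herm (Fin 2)) (F G : Matrix p n ℂ) (E : Matrix q n ℂ)
    (Z : Herm n) : Prop :=
  ∀ a ∈ dict Φ Ψ F G, herForm Z a ≤ normSqE E a

/-- The constraint `‖E a‖² + aᴴ Z a ≥ 0` for all `a ∈ 𝒜` of the dual problem. -/
def DualFeasible (Φ Ψ : Herm (Fin 2)) (F G : Matrix p n ℂ) (E : Matrix q n ℂ)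
    (Z : Herm n) : Prop :=
  ∀ a ∈ dict Φ Ψ F G, 0 ≤ normSqE E a + herForm Z a

/-- The objective `-f*(Z)` of the dual problem. -/
def dualObj (f : Herm n → ℝ) (Z : Herm n) : EReal :=
  -conjugate (fun X => (f X : EReal)) Z

/-- The optimal value of: maximize `-f*(Z) - g*(-Z)` over all Hermitian `Z`. -/
def dualValue (Φ Ψ : Herm (Fin 2)) (F G : Matrix p n ℂ) (E : Matrix q n ℂ)
    (f : Herm n → ℝ) : EReal :=
  ⨆ Z : Herm n, dualObj f Z - conjugate (symGauge Φ Ψ F G E) (-Z)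

/-- The objective `f(X) + ∑ₖ ‖E aₖ‖²` at `X = ∑ₖ aₖ aₖᴴ`. -/
def primalObj (E : Matrix q n ℂ) (f : Herm n → ℝ) {r : ℕ} (a : Fin r → n → ℂ) : ℝ :=
  f (∑ k, dyad (a k)) + ∑ k, normSqE E (a k)

/-- The optimal value of: minimize `f(X) + ∑ₖ ‖E aₖ‖²` over all `X = ∑ₖ aₖ aₖᴴ` with finitely
many `aₖ ∈ 𝒜`. -/
def primalValue (Φ Ψ : Herm (Fin 2)) (F G : Matrix p n ℂ) (E : Matrix q n ℂ)
    (f : Herm n → ℝ) : EReal :=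
  ⨅ (r : ℕ) (a : Fin r → n → ℂ) (_ : ∀ k, a k ∈ dict Φ Ψ F G), (primalObj E f a : EReal)

end pencil

section system

variable {s m : ℕ}

/-- Controllability of `(A, B)`: the matrix `[B, A B, …, A^(s-1) B]` has rank `s`. -/
def Controllable (A : Matrix (Fin s) (Fin s) ℂ) (B : Matrix (Fin s) (Fin m) ℂ) : Prop :=
  (Matrix.of fun (i : Fin s) (j : Fin s × Fin m) => (A ^ (j.1 : ℕ) * B) i j.2).rank = s

/-- `F = [A B]`. -/
def sysF (A : Matrix (Fin s) (Fin s) ℂ) (B : Matrix (Fin s) (Fin m) ℂ) :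
    Matrix (Fin s) (Fin s ⊕ Fin m) ℂ := Matrix.fromCols A B

/-- `G = [I 0]`. -/
def sysG (s m : ℕ) : Matrix (Fin s) (Fin s ⊕ Fin m) ℂ := Matrix.fromCols 1 0

/-- The Popov function with central matrix `N`:
`[(z I - A)⁻¹ B; I]ᴴ N [(z I - A)⁻¹ B; I]`. -/
def popov (A : Matrix (Fin s) (Fin s) ℂ) (B : Matrix (Fin s) (Fin m) ℂ)
    (N : Matrix (Fin s ⊕ Fin m) (Fin s ⊕ Fin m) ℂ) (z : ℂ) : Matrix (Fin m) (Fin m) ℂ :=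
  let H : Matrix (Fin s ⊕ Fin m) (Fin m) ℂ := Matrix.fromRows ((z • 1 - A)⁻¹ * B) 1
  Hᴴ * N * H

/-- The frequency-domain constraints: the Popov function with central matrix `Eᴴ E + Z` is
positive semidefinite on the finite part of `𝒞`, and the `(2,2)` block of `Eᴴ E + Z` is positive
semidefinite if `𝒞` contains the point at infinity. -/
def PopovFeasible {q : Type*} [Fintype q] (Φ Ψ : Herm (Fin 2)) (A : Matrix (Fin s) (Fin s) ℂ)
    (B : Matrix (Fin s) (Fin m) ℂ) (E : Matrix q (Fin s ⊕ Fin m) ℂ)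
    (Z : Herm (Fin s ⊕ Fin m)) : Prop :=
  (∀ z : ℂ, (z, 1) ∈ curve Φ Ψ → (popov A B (Eᴴ * E + (Z : Matrix _ _ ℂ)) z).PosSemidef) ∧
    ((1, 0) ∈ curve Φ Ψ → (Eᴴ * E + (Z : Matrix _ _ ℂ)).toBlocks₂₂.PosSemidef)

end system

end

end SymGauge

/-!
A congruence of `ℂ²` brings the pair `(Φ, Ψ)` to a normal form in which `𝒞` is the real projective
line or its half `[0, ∞]`. In these coordinates the semidefinite constraints say that `F X Gᴴ` is
Hermitian (and positive semidefinite), so the linear relation between `(F Y)ᴴ` and `(G Y)ᴴ`,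
where `X = Y Yᴴ`, is symmetric. Diagonalizing it writes every feasible `X` as a sum of dyads `a aᴴ`
with `a ∈ 𝒜`, and since `tr (E X Eᴴ)` is linear, it is the gauge on the feasible cone.

Consequently (iii) says that `tr (X Z) ≤ tr (E X Eᴴ)` on the feasible cone, and `P`, `Q` are the
multipliers of the two matrix constraints. They exist because the constraints are strictly feasible:
by the rank condition, the kernels of the pencil at any infinite set of points of the projective
line span `ℂⁿ`. If `q_Ψ ≤ 0` is redundant, strict feasibility may fail for `Ψ`, but its constraint
can be dropped.
-/

namespace SymGauge

noncomputable section

/-! ### Hermitian matrices as a real vector space -/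

section Hermitian

variable {n q : Type*}

lemma Herm.isHermitian (X : Herm n) : (X : Matrix n n ℂ).IsHermitian := X.2

@[simp] lemma Herm.coe_sum {ι : Type*} (s : Finset ι) (X : ι → Herm n) :
    ((∑ i ∈ s, X i : Herm n) : Matrix n n ℂ) = ∑ i ∈ s, (X i : Matrix n n ℂ) :=
  AddSubgroup.val_finsetSum _ _ _

instance [Finite n] : FiniteDimensional ℝ (Herm n) :=
  Module.Finite.of_injective (selfAdjoint.submodule ℝ (Matrix n n ℂ)).subtype Subtype.val_injective

@[simp] lemma coe_dyad (a : n → ℂ) :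
    (dyad a : Matrix n n ℂ) = Matrix.vecMulVec a (star a) := rfl

lemma dyad_smul (c : ℝ) (a : n → ℂ) : dyad ((c : ℂ) • a) = c ^ 2 • dyad a := by
  refine Subtype.ext (Matrix.ext fun i j => ?_)
  simp only [coe_dyad, selfAdjoint.val_smul, Matrix.vecMulVec_apply, Matrix.smul_apply,
    Pi.smul_apply, Pi.star_apply, smul_eq_mul, star_mul', Complex.star_def, Complex.conj_ofReal,
    Complex.real_smul, Complex.ofReal_pow]
  ring

/-- The Gram matrix `Eᴴ E` as an element of the space of Hermitian matrices. -/
def gram [Fintype q] (E : Matrix q n ℂ) : Herm n :=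
  ⟨Eᴴ * E, Matrix.isHermitian_conjTranspose_mul_self E⟩

@[simp] lemma coe_gram [Fintype q] (E : Matrix q n ℂ) : (gram E : Matrix n n ℂ) = Eᴴ * E := rfl

/-- The convex cone of positive semidefinite matrices. -/
def psdCone (n : Type*) : PointedCone ℝ (Herm n) where
  carrier := {X | (X : Matrix n n ℂ).PosSemidef}
  zero_mem' := Matrix.PosSemidef.zero
  add_mem' := Matrix.PosSemidef.add
  smul_mem' c _ hX := hX.smul (a := (c : ℝ)) c.2

variable [Fintype n] [Fintype q]

lemma coe_herForm (Z : Herm n) (a : n → ℂ) :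
    (herForm Z a : ℂ) = star a ⬝ᵥ ((Z : Matrix n n ℂ) *ᵥ a) :=
  Complex.ext rfl (Z.isHermitian.im_star_dotProduct_mulVec_self a).symm

lemma posSemidef_iff_herForm {Z : Herm n} :
    (Z : Matrix n n ℂ).PosSemidef ↔ ∀ a, 0 ≤ herForm Z a := by
  simp only [Matrix.posSemidef_iff_dotProduct_mulVec, Z.isHermitian, true_and, ← coe_herForm,
    Complex.zero_le_real]

lemma posDef_iff_herForm {Z : Herm n} :
    (Z : Matrix n n ℂ).PosDef ↔ ∀ a, a ≠ 0 → 0 < herForm Z a := by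
  simp only [Matrix.posDef_iff_dotProduct_mulVec, Z.isHermitian, true_and, ← coe_herForm,
    Complex.zero_lt_real]

@[simp] lemma herForm_add (Z W : Herm n) (a : n → ℂ) :
    herForm (Z + W) a = herForm Z a + herForm W a := by
  simp [herForm, Matrix.add_mulVec, dotProduct_add]

@[simp] lemma herForm_neg (Z : Herm n) (a : n → ℂ) : herForm (-Z) a = -herForm Z a := by
  simp [herForm, Matrix.neg_mulVec]

@[simp] lemma herForm_sub (Z W : Herm n) (a : n → ℂ) :
    herForm (Z - W) a = herForm Z a - herForm W a := by
  simp [sub_eq_add_neg]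

@[simp] lemma herForm_smul (c : ℝ) (Z : Herm n) (a : n → ℂ) :
    herForm (c • Z) a = c * herForm Z a := by
  simp [herForm, Matrix.smul_mulVec]

lemma herForm_smul_right (Z : Herm n) (c : ℂ) (a : n → ℂ) :
    herForm Z (c • a) = ‖c‖ ^ 2 * herForm Z a := by
  apply Complex.ofReal_injective
  rw [Complex.ofReal_mul, coe_herForm, coe_herForm, Complex.ofReal_pow, ← Complex.conj_mul']
  simp only [star_smul, Matrix.mulVec_smul, smul_dotProduct, dotProduct_smul, smul_eq_mul,
    Complex.star_def, mul_assoc]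
  exact mul_left_comm _ _ _

lemma herForm_dyad (a b : n → ℂ) : herForm (dyad a) b = ‖star a ⬝ᵥ b‖ ^ 2 := by
  apply Complex.ofReal_injective
  rw [coe_herForm, coe_dyad, Matrix.vecMulVec_mulVec, dotProduct_smul, op_smul_eq_mul,
    Matrix.star_dotProduct b, Complex.ofReal_pow, ← Complex.conj_mul', Complex.star_def]

lemma herForm_gram (E : Matrix q n ℂ) (a : n → ℂ) : herForm (gram E) a = normSqE E a := by
  rw [herForm, normSqE, EuclideanSpace.norm_sq_eq, coe_gram, ← Matrix.mulVec_mulVec,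
    Matrix.dotProduct_mulVec, Matrix.vecMul_conjTranspose, star_star]
  simp [dotProduct, ← Complex.normSq_eq_norm_sq, Complex.normSq_apply]

lemma trInner_comm (X Z : Herm n) : trInner X Z = trInner Z X := by
  rw [trInner, trInner, Matrix.trace_mul_comm]

@[simp] lemma trInner_sub_right (X Y Z : Herm n) :
    trInner X (Y - Z) = trInner X Y - trInner X Z := by
  simp [trInner, mul_sub]

@[simp] lemma trInner_zero_right (X : Herm n) : trInner X 0 = 0 := by
  simp [trInner]

lemma trInner_dyad (a : n → ℂ) (Z : Herm n) : trInner (dyad a) Z = herForm Z a := by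
  rw [trInner, herForm, coe_dyad, Matrix.vecMulVec_mul, Matrix.trace_vecMulVec,
    Matrix.dotProduct_mulVec, dotProduct_comm]

lemma trInner_gram (X : Herm n) (E : Matrix q n ℂ) :
    trInner X (gram E) = (E * (X : Matrix n n ℂ) * Eᴴ).trace.re := by
  rw [trInner, coe_gram, Matrix.mul_assoc, Matrix.trace_mul_comm E, Matrix.mul_assoc]

/-- The inner product `tr (X Z)` as a real bilinear form. -/
def trForm : Herm n →ₗ[ℝ] Herm n →ₗ[ℝ] ℝ :=
  LinearMap.mk₂ ℝ trInner (by simp [trInner, add_mul]) (by simp [trInner])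
    (by simp [trInner, mul_add]) (by simp [trInner])

@[simp] lemma trForm_apply (X Z : Herm n) : trForm X Z = trInner X Z := rfl

lemma trInner_sum_dyad {ι : Type*} (s : Finset ι) (a : ι → n → ℂ) (Z : Herm n) :
    trInner (∑ i ∈ s, dyad (a i)) Z = ∑ i ∈ s, herForm Z (a i) := by
  simp_rw [← trInner_dyad, ← trForm_apply, map_sum, LinearMap.sum_apply]

lemma trInner_self_eq_zero {X : Herm n} (h : trInner X X = 0) : X = 0 := by
  have htrace : ((X : Matrix n n ℂ)ᴴ * (X : Matrix n n ℂ)).trace = 0 := by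
    refine Complex.ext (by rw [X.isHermitian.eq]; exact h) ?_
    exact (Complex.le_def.1
      (Matrix.posSemidef_conjTranspose_mul_self (X : Matrix n n ℂ)).trace_nonneg).2.symm
  exact Subtype.ext (Matrix.trace_conjTranspose_mul_self_eq_zero_iff.1 htrace)

lemma trForm_surjective : Function.Surjective (trForm (n := n)) := by
  have hker : LinearMap.ker (trForm (n := n)) = ⊥ :=
    LinearMap.ker_eq_bot'.2 fun X hX => trInner_self_eq_zero (LinearMap.congr_fun hX X)
  exact (LinearMap.injective_iff_surjective_of_finrank_eq_finrank
    Subspace.dual_finrank_eq.symm).1 (LinearMap.ker_eq_bot.1 hker)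

end Hermitian

/-! ### The pencil map and its adjoint -/

lemma Herm.conj_apply {n : Type*} (Θ : Herm n) (i j : n) :
    star ((Θ : Matrix n n ℂ) i j) = (Θ : Matrix n n ℂ) j i := Θ.isHermitian.apply j i

lemma quadForm_eq_herForm (Θ : Herm (Fin 2)) (μ ν : ℂ) : quadForm Θ μ ν = herForm Θ ![μ, ν] := rfl

lemma coe_quadForm (Θ : Herm (Fin 2)) (μ ν : ℂ) :
    (quadForm Θ μ ν : ℂ) = (Θ : Matrix (Fin 2) (Fin 2) ℂ) 0 0 * (star μ * μ) +
      (Θ : Matrix (Fin 2) (Fin 2) ℂ) 1 0 * (μ * star ν) +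
      (Θ : Matrix (Fin 2) (Fin 2) ℂ) 0 1 * (ν * star μ) +
      (Θ : Matrix (Fin 2) (Fin 2) ℂ) 1 1 * (star ν * ν) := by
  rw [quadForm_eq_herForm, coe_herForm]
  simp [Matrix.mulVec, dotProduct, Fin.sum_univ_two]
  ring

lemma quadForm_smul (Θ : Herm (Fin 2)) (c μ ν : ℂ) :
    quadForm Θ (c * μ) (c * ν) = ‖c‖ ^ 2 * quadForm Θ μ ν := by
  simpa only [quadForm_eq_herForm, Matrix.smul_cons, Matrix.smul_empty, smul_eq_mul] using
    herForm_smul_right Θ c ![μ, ν]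

section Pencil

lemma stack_conjTranspose_mul_kronecker_mul_stack {p n : Type*} [Fintype p]
    (Θ : Matrix (Fin 2) (Fin 2) ℂ) (F G : Matrix p n ℂ) (P : Matrix p p ℂ) :
    (stack F G)ᴴ * (Θ ⊗ₖ P) * stack F G =
      Θ 0 0 • (Fᴴ * P * F) + Θ 0 1 • (Fᴴ * P * G) + Θ 1 0 • (Gᴴ * P * F) +
        Θ 1 1 • (Gᴴ * P * G) := by
  ext i j
  simp only [Matrix.mul_apply, Fintype.sum_prod_type, Fin.sum_univ_two, stack,
    Matrix.conjTranspose_apply, Matrix.of_apply, Matrix.kroneckerMap_apply, Matrix.add_apply,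
    Matrix.smul_apply, smul_eq_mul, Finset.sum_mul, Finset.mul_sum, Matrix.cons_val_zero,
    Matrix.cons_val_one, add_mul, ← Finset.sum_add_distrib]
  refine Finset.sum_congr rfl fun _ _ => Finset.sum_congr rfl fun _ _ => ?_
  ring

variable {p n q : Type*} [Fintype n]

lemma pencilMap_isHermitian (Θ : Herm (Fin 2)) (F G : Matrix p n ℂ) (X : Herm n) :
    (pencilMap Θ F G X).IsHermitian := by
  rw [Matrix.IsHermitian]
  simp only [pencilMap, Matrix.conjTranspose_add, Matrix.conjTranspose_smul,
    Matrix.conjTranspose_mul, Matrix.conjTranspose_conjTranspose, X.isHermitian.eq, Θ.conj_apply,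
    Matrix.mul_assoc]
  abel

/-- The map `X ↦ pencilMap Θ F G X` as a real linear map between spaces of Hermitian matrices. -/
def pencilHerm (Θ : Herm (Fin 2)) (F G : Matrix p n ℂ) : Herm n →ₗ[ℝ] Herm p where
  toFun X := ⟨pencilMap Θ F G X, pencilMap_isHermitian Θ F G X⟩
  map_add' X Y := by
    apply Subtype.ext
    simp only [pencilMap, AddSubgroup.coe_add, Matrix.mul_add, Matrix.add_mul, smul_add]
    abel
  map_smul' c X := by
    apply Subtype.ext
    simp only [pencilMap, selfAdjoint.val_smul, Matrix.mul_smul, Matrix.smul_mul, smul_add,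
      RingHom.id_apply, smul_comm _ c]

@[simp] lemma coe_pencilHerm (Θ : Herm (Fin 2)) (F G : Matrix p n ℂ) (X : Herm n) :
    (pencilHerm Θ F G X : Matrix p p ℂ) = pencilMap Θ F G X := rfl

/-- The convex cone of matrices that satisfy the semidefinite constraints `PrimalFeasible`. -/
def feasibleCone (Φ Ψ : Herm (Fin 2)) (F G : Matrix p n ℂ) : PointedCone ℝ (Herm n) :=
  psdCone n ⊓ .ofSubmodule (LinearMap.ker (pencilHerm Φ F G)) ⊓
    (psdCone p).comap (-pencilHerm Ψ F G)

lemma mem_feasibleCone {Φ Ψ : Herm (Fin 2)} {F G : Matrix p n ℂ} {X : Herm n} :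
    X ∈ feasibleCone Φ Ψ F G ↔ PrimalFeasible Φ Ψ F G X := by
  rw [PrimalFeasible, ← and_assoc, ← coe_pencilHerm Φ, ZeroMemClass.coe_eq_zero]
  rfl

lemma mul_dyad_mul (K L : Matrix p n ℂ) (a : n → ℂ) :
    K * (dyad a : Matrix n n ℂ) * Lᴴ = Matrix.vecMulVec (K *ᵥ a) (star (L *ᵥ a)) := by
  rw [coe_dyad, Matrix.mul_vecMulVec, Matrix.vecMulVec_mul, Matrix.star_mulVec]

lemma pencilHerm_dyad (Θ : Herm (Fin 2)) {F G : Matrix p n ℂ} {a : n → ℂ} {s : p → ℂ} {μ ν : ℂ}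
    (hF : F *ᵥ a = μ • s) (hG : G *ᵥ a = ν • s) :
    pencilHerm Θ F G (dyad a) = quadForm Θ μ ν • dyad s := by
  refine Subtype.ext (Matrix.ext fun i j => ?_)
  rw [coe_pencilHerm, selfAdjoint.val_smul, ← Complex.coe_smul, coe_quadForm]
  simp only [pencilMap, mul_dyad_mul, hF, hG]
  simp only [coe_dyad, Matrix.add_apply, Matrix.smul_apply, Matrix.vecMulVec_apply, Pi.smul_apply,
    Pi.star_apply, smul_eq_mul, star_mul']
  ring

lemma exists_eq_smul_and_eq_smul {K V : Type*} [Field K] [AddCommGroup V] [Module K V] {μ ν : K}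
    (h : (μ, ν) ≠ 0) {f g : V} (hfg : μ • g = ν • f) : ∃ s, f = μ • s ∧ g = ν • s := by
  by_cases hμ : μ = 0
  · have hν : ν ≠ 0 := fun hν => h (Prod.ext hμ hν)
    exact ⟨ν⁻¹ • g, by rw [smul_comm, hfg, inv_smul_smul₀ hν], by rw [smul_inv_smul₀ hν]⟩
  · exact ⟨μ⁻¹ • f, by rw [smul_inv_smul₀ hμ], by rw [smul_comm, ← hfg, inv_smul_smul₀ hμ]⟩

lemma exists_mulVec_eq_smul {F G : Matrix p n ℂ} {x : ℂ × ℂ} {a : n → ℂ} (hx : x ≠ 0)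
    (h : (x.1 • G - x.2 • F) *ᵥ a = 0) : ∃ s, F *ᵥ a = x.1 • s ∧ G *ᵥ a = x.2 • s :=
  exists_eq_smul_and_eq_smul hx <| by
    rwa [Matrix.sub_mulVec, Matrix.smul_mulVec, Matrix.smul_mulVec, sub_eq_zero] at h

lemma smul_mem_dict {Φ Ψ : Herm (Fin 2)} {F G : Matrix p n ℂ} {a : n → ℂ} (c : ℂ)
    (ha : a ∈ dict Φ Ψ F G) : c • a ∈ dict Φ Ψ F G := by
  obtain ⟨x, hx, hxa⟩ := ha
  exact ⟨x, hx, by rw [Matrix.mulVec_smul, hxa, smul_zero]⟩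

lemma dyad_mem_feasibleCone [Finite p] {Φ Ψ : Herm (Fin 2)} {F G : Matrix p n ℂ} {a : n → ℂ}
    (ha : a ∈ dict Φ Ψ F G) : dyad a ∈ feasibleCone Φ Ψ F G := by
  obtain ⟨x, ⟨hx0, hxΦ, hxΨ⟩, hxa⟩ := ha
  obtain ⟨s, hF, hG⟩ := exists_mulVec_eq_smul hx0 hxa
  have hΨ : -pencilHerm Ψ F G (dyad a) ∈ psdCone p := by
    rw [pencilHerm_dyad Ψ hF hG, ← neg_smul]
    exact (psdCone p).smul_mem (neg_nonneg.2 hxΨ) (Matrix.posSemidef_vecMulVec_self_star s)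
  refine mem_feasibleCone.2 ⟨Matrix.posSemidef_vecMulVec_self_star a, ?_, hΨ⟩
  rw [← coe_pencilHerm, pencilHerm_dyad Φ hF hG, hxΦ, zero_smul, ZeroMemClass.coe_zero]

lemma normSqE_smul [Fintype q] (E : Matrix q n ℂ) (c : ℂ) (a : n → ℂ) :
    normSqE E (c • a) = ‖c‖ ^ 2 * normSqE E a := by
  rw [← herForm_gram, herForm_smul_right, herForm_gram]

variable [Fintype p]

/-- The Hermitian matrix `[F; G]ᴴ (Θ ⊗ P) [F; G]`, the image of `P` under the adjoint of the pencil
map. -/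
def stackHerm {n : Type*} (Θ : Herm (Fin 2)) (F G : Matrix p n ℂ) (P : Herm p) : Herm n :=
  ⟨(stack F G)ᴴ * ((Θ : Matrix (Fin 2) (Fin 2) ℂ) ⊗ₖ (P : Matrix p p ℂ)) * stack F G,
    Matrix.isHermitian_conjTranspose_mul_mul _ (by
      rw [Matrix.IsHermitian, Matrix.conjTranspose_kronecker, Θ.isHermitian.eq, P.isHermitian.eq])⟩

@[simp] lemma coe_stackHerm {n : Type*} (Θ : Herm (Fin 2)) (F G : Matrix p n ℂ) (P : Herm p) :
    (stackHerm Θ F G P : Matrix n n ℂ) =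
      (stack F G)ᴴ * ((Θ : Matrix (Fin 2) (Fin 2) ℂ) ⊗ₖ (P : Matrix p p ℂ)) * stack F G := rfl

lemma trInner_stackHerm (Θ : Herm (Fin 2)) (F G : Matrix p n ℂ) (X : Herm n) (P : Herm p) :
    trInner X (stackHerm Θ F G P) = trInner (pencilHerm Θ F G X) P := by
  have trace_cycle (K L : Matrix p n ℂ) :
      ((X : Matrix n n ℂ) * (Kᴴ * (P : Matrix p p ℂ) * L)).trace =
        (L * (X : Matrix n n ℂ) * Kᴴ * (P : Matrix p p ℂ)).trace := by
    rw [Matrix.trace_mul_comm, Matrix.mul_assoc, Matrix.mul_assoc, Matrix.trace_mul_comm,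
      Matrix.mul_assoc, Matrix.trace_mul_comm]
  rw [trInner, trInner, coe_stackHerm, stack_conjTranspose_mul_kronecker_mul_stack, coe_pencilHerm]
  simp only [pencilMap, Matrix.mul_add, Matrix.add_mul, Matrix.mul_smul, Matrix.smul_mul,
    Matrix.trace_add, Matrix.trace_smul, trace_cycle]
  congr 1
  ring

end Pencil

/-! ### Simultaneous diagonalization -/

section SymmetricRelation

variable {𝕜 V E : Type*} [RCLike 𝕜] [AddCommGroup V] [Module 𝕜 V] [NormedAddCommGroup E]
  [InnerProductSpace 𝕜 E] {c d : V →ₗ[𝕜] E}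

lemma exists_isSymmetric_of_inner_comm [FiniteDimensional 𝕜 E]
    (hcd : ∀ x y, inner 𝕜 (c x) (d y) = inner 𝕜 (d x) (c y)) :
    ∃ H : LinearMap.range d →ₗ[𝕜] LinearMap.range d, H.IsSymmetric ∧
      ∀ x (u : LinearMap.range d), inner 𝕜 (c x) (u : E) = inner 𝕜 (d x) (H u : E) := by
  obtain ⟨S, hS⟩ := d.rangeRestrict.exists_rightInverse_of_surjective d.range_rangeRestrict
  have hdS (u : LinearMap.range d) : d (S u) = u :=
    congrArg Subtype.val (LinearMap.congr_fun hS u)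
  let H := ((LinearMap.range d).orthogonalProjectionOnto : E →ₗ[𝕜] LinearMap.range d) ∘ₗ c ∘ₗ S
  have hH (x : V) (u : LinearMap.range d) : inner 𝕜 (c x) (u : E) = inner 𝕜 (d x) (H u : E) := by
    rw [← hdS u, hcd]
    exact ((LinearMap.range d).inner_orthogonalProjectionOnto_eq_of_mem_left
      (d.rangeRestrict x) (c (S u))).symm
  refine ⟨H, ?_, hH⟩
  intro u v
  calc inner 𝕜 (H u) v = inner 𝕜 (H u : E) (d (S v)) := by rw [hdS, Submodule.coe_inner]
    _ = inner 𝕜 (u : E) (c (S v)) := by rw [← inner_conj_symm, ← hH, inner_conj_symm]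
    _ = inner 𝕜 (d (S u)) (c (S v)) := by rw [hdS]
    _ = inner 𝕜 (d (S u)) (H v : E) := by rw [← hcd, hdS v, hH]
    _ = inner 𝕜 u (H v) := by rw [hdS, Submodule.coe_inner]

/-- The vectors `w i` are an orthonormal basis that diagonalizes a self-adjoint extension of the
symmetric linear relation `{(d x, c x)}`, whose multivalued part is the orthogonal complement of
the range of `d`. -/
lemma exists_diagonal_of_inner_comm [FiniteDimensional 𝕜 E]
    (hcd : ∀ x y, inner 𝕜 (c x) (d y) = inner 𝕜 (d x) (c y)) :
    ∃ (ι : Type) (_ : Fintype ι) (w : ι → E),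
      ∑ i, InnerProductSpace.rankOne 𝕜 (w i) (w i) = .id 𝕜 E ∧
      ∀ i, (∀ x, inner 𝕜 (d x) (w i) = 0) ∨
        ∃ t : ℝ, (∀ x, inner 𝕜 (c x) (w i) = t * inner 𝕜 (d x) (w i)) ∧
          ((∀ x, 0 ≤ RCLike.re (inner 𝕜 (c x) (d x))) → 0 ≤ t) := by
  obtain ⟨H, hsym, hH⟩ := exists_isSymmetric_of_inner_comm hcd
  let b := hsym.eigenvectorBasis rfl
  let b' := stdOrthonormalBasis 𝕜 (LinearMap.range d)ᗮ
  have hb (i) : H (b i) = (hsym.eigenvalues rfl i : 𝕜) • b i := hsym.apply_eigenvectorBasis rfl i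
  refine ⟨_ ⊕ _, inferInstance, Sum.elim (fun i => (b i : E)) (fun j => (b' j : E)), ?_, ?_⟩
  · simp only [Fintype.sum_sum_type, Sum.elim_inl, Sum.elim_inr]
    rw [← b.starProjection_eq_sum_rankOne, ← b'.starProjection_eq_sum_rankOne,
      Submodule.starProjection_orthogonal, add_sub_cancel]
  rintro (i | j)
  · have hcb (x) : inner 𝕜 (c x) (b i : E) = hsym.eigenvalues rfl i * inner 𝕜 (d x) (b i : E) := by
      rw [hH, hb, Submodule.coe_smul, inner_smul_right]
    refine Or.inr ⟨hsym.eigenvalues rfl i, hcb, fun hpos => ?_⟩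
    obtain ⟨x, hx⟩ := (b i).2
    have hxx := hpos x
    rw [hx, hcb, hx, ← Submodule.coe_inner, inner_self_eq_norm_sq_to_K, b.norm_eq_one] at hxx
    simpa using hxx
  · exact Or.inl fun x => (Submodule.mem_orthogonal _ _).1 (b' j).2 _ ⟨x, rfl⟩

end SymmetricRelation

section Matrices

variable {m n p : Type*} [Fintype m] [Fintype n]

lemma inner_toEuclideanLin_conjTranspose [Fintype p] [DecidableEq m] [DecidableEq p]
    (K : Matrix p m ℂ) (x : EuclideanSpace ℂ p) (y : EuclideanSpace ℂ m) :
    inner ℂ (Matrix.toEuclideanLin Kᴴ x) y = inner ℂ x (Matrix.toEuclideanLin K y) := by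
  rw [Matrix.toEuclideanLin_conjTranspose_eq_adjoint, LinearMap.adjoint_inner_left]

lemma inner_toEuclideanLin_conjTranspose_conjTranspose [Fintype p] [DecidableEq p]
    (K L : Matrix p m ℂ) (x y : EuclideanSpace ℂ p) :
    inner ℂ (Matrix.toEuclideanLin Kᴴ x) (Matrix.toEuclideanLin Lᴴ y) =
      inner ℂ x (Matrix.toEuclideanLin (K * Lᴴ) y) := by
  classical
  rw [inner_toEuclideanLin_conjTranspose]
  simp only [Matrix.toLpLin_apply, Matrix.mulVec_mulVec]

lemma mulVec_eq_smul_iff_inner [Fintype p] [DecidableEq p] {K L : Matrix p m ℂ} {t : ℂ}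
    {w : EuclideanSpace ℂ m} :
    K *ᵥ w.ofLp = t • L *ᵥ w.ofLp ↔ ∀ x : EuclideanSpace ℂ p,
      inner ℂ (Matrix.toEuclideanLin Kᴴ x) w = t * inner ℂ (Matrix.toEuclideanLin Lᴴ x) w := by
  classical
  simp only [inner_toEuclideanLin_conjTranspose, ← inner_smul_right, ← ext_iff_inner_left]
  exact (WithLp.ofLp_injective 2).eq_iff (a := Matrix.toEuclideanLin K w)
    (b := t • Matrix.toEuclideanLin L w)

lemma exists_diagonal_of_mul_conjTranspose_comm [Finite p] [DecidableEq m] {C D : Matrix p m ℂ}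
    (h : D * Cᴴ = C * Dᴴ) :
    ∃ (ι : Type) (_ : Fintype ι) (w : ι → m → ℂ),
      ∑ i, Matrix.vecMulVec (w i) (star (w i)) = 1 ∧
      ∀ i, D *ᵥ w i = 0 ∨ ∃ t : ℝ, C *ᵥ w i = (t : ℂ) • D *ᵥ w i ∧
        ((C * Dᴴ).PosSemidef → 0 ≤ t) := by
  classical
  cases nonempty_fintype p
  obtain ⟨ι, _, w, hw, hCD⟩ := exists_diagonal_of_inner_comm (c := Matrix.toEuclideanLin Cᴴ)
    (d := Matrix.toEuclideanLin Dᴴ) fun x y => by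
      rw [inner_toEuclideanLin_conjTranspose_conjTranspose,
        inner_toEuclideanLin_conjTranspose_conjTranspose, h]
  refine ⟨ι, ‹_›, fun i => (w i).ofLp, ?_, fun i => (hCD i).imp (fun hD => ?_) ?_⟩
  · have hsum := congrArg Matrix.toEuclideanLin.symm
      (congrArg ContinuousLinearMap.toLinearMap hw)
    simp only [ContinuousLinearMap.toLinearMap_sum, map_sum,
      InnerProductSpace.symm_toEuclideanLin_rankOne] at hsum
    rw [hsum, LinearEquiv.symm_apply_eq]
    simp
  · simpa using (mulVec_eq_smul_iff_inner (L := 0) (t := 0)).2 fun x => (hD x).trans (by simp)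
  · rintro ⟨t, ht, hpos⟩
    refine ⟨t, mulVec_eq_smul_iff_inner.2 ht, fun hpsd => hpos fun x => ?_⟩
    rw [inner_toEuclideanLin_conjTranspose_conjTranspose, EuclideanSpace.inner_eq_star_dotProduct,
      dotProduct_comm]
    exact (Complex.le_def.1 (hpsd.dotProduct_mulVec_nonneg x.ofLp)).1

open scoped MatrixOrder in
lemma exists_sum_dyad_diagonal [Finite p] {F G : Matrix p n ℂ} {X : Herm n}
    (hX : (X : Matrix n n ℂ).PosSemidef)
    (h : G * (X : Matrix n n ℂ) * Fᴴ = F * (X : Matrix n n ℂ) * Gᴴ) :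
    ∃ (r : ℕ) (a : Fin r → n → ℂ), X = ∑ k, dyad (a k) ∧
      ∀ k, G *ᵥ a k = 0 ∨ ∃ t : ℝ, F *ᵥ a k = (t : ℂ) • G *ᵥ a k ∧
        ((F * (X : Matrix n n ℂ) * Gᴴ).PosSemidef → 0 ≤ t) := by
  classical
  obtain ⟨Y, hY⟩ : ∃ Y : Matrix n n ℂ, (X : Matrix n n ℂ) = Y * Yᴴ :=
    CStarAlgebra.nonneg_iff_eq_mul_star_self.1 hX.nonneg
  have hmul (K L : Matrix p n ℂ) : (K * Y) * (L * Y)ᴴ = K * (X : Matrix n n ℂ) * Lᴴ := by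
    simp only [hY, Matrix.conjTranspose_mul, Matrix.mul_assoc]
  obtain ⟨ι, _, w, hw, hFG⟩ := exists_diagonal_of_mul_conjTranspose_comm
    (C := F * Y) (D := G * Y) (by rw [hmul, hmul, h])
  let e := Fintype.equivFin ι
  refine ⟨_, fun k => Y *ᵥ w (e.symm k), Subtype.ext ?_, fun k => ?_⟩
  · simp only [Herm.coe_sum, e.symm.sum_comp fun i => (dyad (Y *ᵥ w i) : Matrix n n ℂ)]
    simp only [coe_dyad, ← mul_dyad_mul, ← Matrix.sum_mul, ← Matrix.mul_sum, hw, Matrix.mul_one, hY]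
  · simpa only [Matrix.mulVec_mulVec, hmul] using hFG (e.symm k)

end Matrices

/-! ### Normal form of a pair of Hermitian forms on `ℂ²` -/

section NormalForm

variable {p n : Type*} [Fintype n]

/-- The Hermitian matrix `Tᴴ Θ T` of the form `q_Θ` in the coordinates given by the columns
of `T`. -/
def congruence (T : Matrix (Fin 2) (Fin 2) ℂ) (Θ : Herm (Fin 2)) : Herm (Fin 2) :=
  ⟨Tᴴ * (Θ : Matrix (Fin 2) (Fin 2) ℂ) * T,
    Matrix.isHermitian_conjTranspose_mul_mul _ Θ.isHermitian⟩

lemma congruence_apply (T : Matrix (Fin 2) (Fin 2) ℂ) (Θ : Herm (Fin 2)) (i j : Fin 2) :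
    (congruence T Θ : Matrix (Fin 2) (Fin 2) ℂ) i j =
      star (T 0 i) * ((Θ : Matrix (Fin 2) (Fin 2) ℂ) 0 0 * T 0 j +
        (Θ : Matrix (Fin 2) (Fin 2) ℂ) 0 1 * T 1 j) +
      star (T 1 i) * ((Θ : Matrix (Fin 2) (Fin 2) ℂ) 1 0 * T 0 j +
        (Θ : Matrix (Fin 2) (Fin 2) ℂ) 1 1 * T 1 j) := by
  simp only [congruence, Matrix.mul_apply, Fin.sum_univ_two, Matrix.conjTranspose_apply]
  ring

lemma congruence_mul (T S : Matrix (Fin 2) (Fin 2) ℂ) (Θ : Herm (Fin 2)) :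
    congruence (T * S) Θ = congruence S (congruence T Θ) := by
  apply Subtype.ext
  simp only [congruence, Matrix.conjTranspose_mul, Matrix.mul_assoc]

lemma det_congruence_ne_zero {T : Matrix (Fin 2) (Fin 2) ℂ} (hT : T.det ≠ 0) {Θ : Herm (Fin 2)}
    (hΘ : (Θ : Matrix (Fin 2) (Fin 2) ℂ).det ≠ 0) :
    (congruence T Θ : Matrix (Fin 2) (Fin 2) ℂ).det ≠ 0 := by
  simp only [congruence, Matrix.det_mul, Matrix.det_conjTranspose]
  exact mul_ne_zero (mul_ne_zero (star_ne_zero.2 hT) hΘ) hT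

lemma quadForm_congruence (T : Matrix (Fin 2) (Fin 2) ℂ) (Θ : Herm (Fin 2)) (α β : ℂ) :
    quadForm (congruence T Θ) α β =
      quadForm Θ (T 0 0 * α + T 0 1 * β) (T 1 0 * α + T 1 1 * β) := by
  apply Complex.ofReal_injective
  rw [coe_quadForm, coe_quadForm]
  simp only [congruence_apply, star_add, star_mul']
  ring

lemma pencilMap_congruence (T : Matrix (Fin 2) (Fin 2) ℂ) (Θ : Herm (Fin 2)) (C D : Matrix p n ℂ)
    (X : Herm n) :
    pencilMap Θ (T 0 0 • C + T 0 1 • D) (T 1 0 • C + T 1 1 • D) X =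
      pencilMap (congruence T Θ) C D X := by
  simp only [pencilMap, congruence_apply, Matrix.add_mul, Matrix.mul_add, Matrix.smul_mul,
    Matrix.mul_smul, Matrix.conjTranspose_add, Matrix.conjTranspose_smul, smul_add]
  module

lemma exists_eq_combination {T : Matrix (Fin 2) (Fin 2) ℂ} (hT : T.det ≠ 0) {M : Type*}
    [AddCommGroup M] [Module ℂ M] (F G : M) :
    ∃ C D : M, F = T 0 0 • C + T 0 1 • D ∧ G = T 1 0 • C + T 1 1 • D := by
  have h : T.det⁻¹ * (T 0 0 * T 1 1 - T 0 1 * T 1 0) = 1 := by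
    rw [← Matrix.det_fin_two, inv_mul_cancel₀ hT]
  refine ⟨T.det⁻¹ • (T 1 1 • F - T 0 1 • G), T.det⁻¹ • (T 0 0 • G - T 1 0 • F), ?_, ?_⟩
  · match_scalars
    · linear_combination -h
    · ring
  · match_scalars
    · linear_combination -h
    · ring

lemma combination_ne_zero {T : Matrix (Fin 2) (Fin 2) ℂ} (hT : T.det ≠ 0) {α β : ℂ}
    (h : (α, β) ≠ 0) : (T 0 0 * α + T 0 1 * β, T 1 0 * α + T 1 1 * β) ≠ 0 := by
  contrapose! h
  obtain ⟨h₁, h₂⟩ := Prod.ext_iff.1 h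
  simp only [Prod.fst_zero, Prod.snd_zero] at h₁ h₂
  rw [Matrix.det_fin_two] at hT
  exact Prod.ext ((mul_eq_zero_iff_left hT).1 (by linear_combination T 1 1 * h₁ - T 0 1 * h₂))
    ((mul_eq_zero_iff_left hT).1 (by linear_combination T 0 0 * h₂ - T 1 0 * h₁))

lemma dict_congruence_subset {T : Matrix (Fin 2) (Fin 2) ℂ} (hT : T.det ≠ 0) (Φ Ψ : Herm (Fin 2))
    (C D : Matrix p n ℂ) :
    dict (congruence T Φ) (congruence T Ψ) C D ⊆
      dict Φ Ψ (T 0 0 • C + T 0 1 • D) (T 1 0 • C + T 1 1 • D) := by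
  rintro a ⟨⟨α, β⟩, ⟨h0, hΦ, hΨ⟩, ha⟩
  rw [quadForm_congruence] at hΦ hΨ
  refine ⟨_, ⟨combination_ne_zero hT h0, hΦ, hΨ⟩, ?_⟩
  have hdet : (T 0 0 * α + T 0 1 * β) • (T 1 0 • C + T 1 1 • D) -
      (T 1 0 * α + T 1 1 * β) • (T 0 0 • C + T 0 1 • D) = T.det • (α • D - β • C) := by
    rw [Matrix.det_fin_two]
    module
  rw [hdet, Matrix.smul_mulVec, ha, smul_zero]

lemma quadForm_eq_re (Θ : Herm (Fin 2)) (μ ν : ℂ) :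
    quadForm Θ μ ν = ((Θ : Matrix (Fin 2) (Fin 2) ℂ) 0 0).re * Complex.normSq μ +
      ((Θ : Matrix (Fin 2) (Fin 2) ℂ) 1 1).re * Complex.normSq ν +
      2 * ((Θ : Matrix (Fin 2) (Fin 2) ℂ) 0 1 * (ν * star μ)).re := by
  have h := congrArg Complex.re (coe_quadForm Θ μ ν)
  rw [← Θ.conj_apply 0 1] at h
  simp [Complex.normSq_apply] at h ⊢
  linear_combination h

lemma quadForm_one_zero (Θ : Herm (Fin 2)) :
    quadForm Θ 1 0 = ((Θ : Matrix (Fin 2) (Fin 2) ℂ) 0 0).re := by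
  simp [quadForm_eq_re]

lemma quadForm_zero_one (Θ : Herm (Fin 2)) :
    quadForm Θ 0 1 = ((Θ : Matrix (Fin 2) (Fin 2) ℂ) 1 1).re := by
  simp [quadForm_eq_re]

/-- The Hermitian matrix `[0, z; z̄, 0]`. For purely imaginary `z ≠ 0` its form vanishes exactly
on the real points of the closed plane, and for `Re z < 0` it is nonpositive at a real point `t`
exactly when `t ≥ 0`. -/
def antidiag (z : ℂ) : Herm (Fin 2) :=
  ⟨!![0, z; star z, 0], by ext i j; fin_cases i <;> fin_cases j <;> simp⟩

lemma eq_antidiag_iff {Θ : Herm (Fin 2)} {z : ℂ} :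
    Θ = antidiag z ↔ ((Θ : Matrix (Fin 2) (Fin 2) ℂ) 0 0).re = 0 ∧
      ((Θ : Matrix (Fin 2) (Fin 2) ℂ) 1 1).re = 0 ∧ (Θ : Matrix (Fin 2) (Fin 2) ℂ) 0 1 = z := by
  refine ⟨by rintro rfl; simp [antidiag], fun ⟨h00, h11, h01⟩ => Subtype.ext ?_⟩
  have him (i) : ((Θ : Matrix (Fin 2) (Fin 2) ℂ) i i).im = 0 :=
    Complex.conj_eq_iff_im.1 (Θ.conj_apply i i)
  ext i j
  fin_cases i <;> fin_cases j
  · exact Complex.ext h00 (him 0)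
  · exact h01
  · simpa [antidiag, h01] using (Θ.conj_apply 0 1).symm
  · exact Complex.ext h11 (him 1)

lemma quadForm_antidiag (z μ ν : ℂ) :
    quadForm (antidiag z) μ ν = 2 * (z * (ν * star μ)).re := by
  simp [quadForm_eq_re, antidiag]

lemma quadForm_antidiag_mul_I (c : ℝ) (μ ν : ℂ) :
    quadForm (antidiag (c * Complex.I)) μ ν = -(2 * c * (ν * star μ).im) := by
  simp [quadForm_antidiag]
  ring

lemma pencilMap_antidiag (z : ℂ) (C D : Matrix p n ℂ) (X : Herm n) :
    pencilMap (antidiag z) C D X = star z • (C * (X : Matrix n n ℂ) * Dᴴ) +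
      z • (D * (X : Matrix n n ℂ) * Cᴴ) := by
  simp [pencilMap, antidiag]

/-- Real changes of coordinates preserve the real line. -/
lemma congruence_antidiag_mul_I (S : Matrix (Fin 2) (Fin 2) ℝ) (c : ℝ) :
    congruence (S.map Complex.ofReal) (antidiag (c * Complex.I)) =
      antidiag ((S.det * c : ℝ) * Complex.I) := by
  rw [eq_antidiag_iff]
  refine ⟨?_, ?_, ?_⟩
  · simp [congruence_apply, antidiag]
  · simp [congruence_apply, antidiag]
  · simp [congruence_apply, antidiag, Matrix.det_fin_two]; ring

/-- Take two independent points of the curve as basis of `ℂ²`. -/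
lemma IsOneDimensional.exists_congruence_eq_antidiag {Φ Ψ : Herm (Fin 2)}
    (hΦ : (Φ : Matrix (Fin 2) (Fin 2) ℂ).det ≠ 0) (hC : IsOneDimensional Φ Ψ) :
    ∃ (T : Matrix (Fin 2) (Fin 2) ℂ) (φ : ℂ), T.det ≠ 0 ∧ φ ≠ 0 ∧
      congruence T Φ = antidiag φ ∧ quadForm (congruence T Ψ) 1 0 ≤ 0 ∧
      quadForm (congruence T Ψ) 0 1 ≤ 0 := by
  obtain ⟨x, ⟨-, hxΦ, hxΨ⟩, y, ⟨-, hyΦ, hyΨ⟩, hxy⟩ := hC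
  let T := !![x.1, y.1; x.2, y.2]
  have hT : T.det ≠ 0 := by
    rw [Matrix.det_fin_two_of]
    exact fun h => hxy (by linear_combination h)
  have hx (Θ) : quadForm (congruence T Θ) 1 0 = quadForm Θ x.1 x.2 := by
    simp [quadForm_congruence, T]
  have hy (Θ) : quadForm (congruence T Θ) 0 1 = quadForm Θ y.1 y.2 := by
    simp [quadForm_congruence, T]
  have hΦT : congruence T Φ = antidiag ((congruence T Φ : Matrix (Fin 2) (Fin 2) ℂ) 0 1) :=
    eq_antidiag_iff.2 ⟨by rw [← quadForm_one_zero, hx, hxΦ], by rw [← quadForm_zero_one, hy, hyΦ],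
      rfl⟩
  refine ⟨T, _, hT, fun h0 => det_congruence_ne_zero hT hΦ ?_, hΦT, (hx Ψ).trans_le hxΨ,
    (hy Ψ).trans_le hyΨ⟩
  rw [hΦT, h0]
  simp [antidiag]

/-- Rescaling the second basis vector makes the off-diagonal entry of `Φ` imaginary, and a change
of its sign makes that of `Ψ` have nonnegative real part. -/
lemma IsOneDimensional.exists_congruence_eq_antidiag_mul_I {Φ Ψ : Herm (Fin 2)}
    (hΦ : (Φ : Matrix (Fin 2) (Fin 2) ℂ).det ≠ 0) (hC : IsOneDimensional Φ Ψ) :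
    ∃ (T : Matrix (Fin 2) (Fin 2) ℂ) (c : ℝ), T.det ≠ 0 ∧ c ≠ 0 ∧
      congruence T Φ = antidiag (c * Complex.I) ∧ quadForm (congruence T Ψ) 1 0 ≤ 0 ∧
      quadForm (congruence T Ψ) 0 1 ≤ 0 ∧
      0 ≤ ((congruence T Ψ : Matrix (Fin 2) (Fin 2) ℂ) 0 1).re := by
  obtain ⟨T, φ, hT, hφ, hΦT, hΨ₀, hΨ₁⟩ := hC.exists_congruence_eq_antidiag hΦ
  obtain ⟨σ, hσ, hσΨ⟩ : ∃ σ : ℝ, σ ≠ 0 ∧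
      0 ≤ σ * ((congruence T Ψ : Matrix (Fin 2) (Fin 2) ℂ) 0 1 * (Complex.I / φ)).re := by
    rcases le_total 0 ((congruence T Ψ : Matrix (Fin 2) (Fin 2) ℂ) 0 1 * (Complex.I / φ)).re
      with h | h
    · exact ⟨1, one_ne_zero, by rwa [one_mul]⟩
    · exact ⟨-1, by norm_num, by rwa [neg_one_mul, neg_nonneg]⟩
  let w : ℂ := σ * (Complex.I / φ)
  have hw : w ≠ 0 := by simp [w, hσ, hφ]
  let S : Matrix (Fin 2) (Fin 2) ℂ := !![1, 0; 0, w]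
  have h01 (Θ : Herm (Fin 2)) : (congruence S Θ : Matrix (Fin 2) (Fin 2) ℂ) 0 1 =
      (Θ : Matrix (Fin 2) (Fin 2) ℂ) 0 1 * w := by
    simp [congruence_apply, S]
  have hquad (Θ : Herm (Fin 2)) (α β : ℂ) :
      quadForm (congruence S Θ) α β = quadForm Θ α (w * β) := by
    simp [quadForm_congruence, S]
  refine ⟨T * S, σ, ?_, hσ, ?_, ?_, ?_, ?_⟩
  · rw [Matrix.det_mul]
    exact mul_ne_zero hT (by simpa [S] using hw)
  · rw [congruence_mul, hΦT, eq_antidiag_iff, ← quadForm_one_zero, ← quadForm_zero_one, hquad,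
      hquad, h01]
    refine ⟨by simp [quadForm_antidiag], by simp [quadForm_antidiag], ?_⟩
    simp only [antidiag, Matrix.of_apply, Matrix.cons_val, w]
    field_simp
  · rwa [congruence_mul, hquad, mul_zero]
  · have := quadForm_smul (congruence T Ψ) w 0 1
    rw [mul_zero] at this
    rw [congruence_mul, hquad, this]
    exact mul_nonpos_of_nonneg_of_nonpos (sq_nonneg _) hΨ₁
  · rw [congruence_mul, h01, ← mul_assoc, mul_comm _ (σ : ℂ), mul_assoc, Complex.re_ofReal_mul]
    exact hσΨ

lemma quadForm_nonpos_of_im_eq_zero {Θ : Herm (Fin 2)} (h0 : quadForm Θ 1 0 ≤ 0)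
    (h1 : quadForm Θ 0 1 ≤ 0)
    (hdet : ((Θ : Matrix (Fin 2) (Fin 2) ℂ) 0 1).re ^ 2 ≤ quadForm Θ 1 0 * quadForm Θ 0 1)
    {μ ν : ℂ} (him : (ν * star μ).im = 0) : quadForm Θ μ ν ≤ 0 := by
  rw [quadForm_one_zero, quadForm_zero_one] at *
  set a := ((Θ : Matrix (Fin 2) (Fin 2) ℂ) 0 0).re
  set d := ((Θ : Matrix (Fin 2) (Fin 2) ℂ) 1 1).re
  set b := ((Θ : Matrix (Fin 2) (Fin 2) ℂ) 0 1)
  have hre : (b * (ν * star μ)).re = b.re * (ν * star μ).re := by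
    rw [Complex.mul_re, him, mul_zero, sub_zero]
  have hsq : (ν * star μ).re ^ 2 = Complex.normSq μ * Complex.normSq ν := by
    have := Complex.normSq_apply (ν * star μ)
    rw [him, map_mul] at this
    simp only [Complex.star_def, Complex.normSq_conj] at this ⊢
    linear_combination -this
  rw [quadForm_eq_re, hre]
  have hμ : a * Complex.normSq μ ≤ 0 :=
    mul_nonpos_of_nonpos_of_nonneg h0 (Complex.normSq_nonneg μ)
  have hν : d * Complex.normSq ν ≤ 0 :=
    mul_nonpos_of_nonpos_of_nonneg h1 (Complex.normSq_nonneg ν)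
  have hcross : (2 * (b.re * (ν * star μ).re)) ^ 2 ≤
      (-(a * Complex.normSq μ + d * Complex.normSq ν)) ^ 2 :=
    calc (2 * (b.re * (ν * star μ).re)) ^ 2
        = 4 * (b.re ^ 2 * (Complex.normSq μ * Complex.normSq ν)) := by rw [← hsq]; ring
      _ ≤ 4 * (a * d * (Complex.normSq μ * Complex.normSq ν)) := by
          have := mul_nonneg (Complex.normSq_nonneg μ) (Complex.normSq_nonneg ν)
          gcongr
      _ ≤ (-(a * Complex.normSq μ + d * Complex.normSq ν)) ^ 2 := by
          linear_combination sq_nonneg (a * Complex.normSq μ - d * Complex.normSq ν)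
  linarith [(abs_le_of_sq_le_sq' hcross (by linarith)).2]

/-- A real indefinite form becomes antidiagonal in the basis of its two isotropic vectors. -/
lemma exists_real_congruence_eq_antidiag {Θ : Herm (Fin 2)}
    (hre : 0 ≤ ((Θ : Matrix (Fin 2) (Fin 2) ℂ) 0 1).re)
    (hdet : quadForm Θ 1 0 * quadForm Θ 0 1 < ((Θ : Matrix (Fin 2) (Fin 2) ℂ) 0 1).re ^ 2) :
    ∃ S : Matrix (Fin 2) (Fin 2) ℝ, S.det ≠ 0 ∧ ∃ z : ℂ, z.re < 0 ∧
      congruence (S.map Complex.ofReal) Θ = antidiag z := by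
  rw [quadForm_one_zero, quadForm_zero_one] at hdet
  set a := ((Θ : Matrix (Fin 2) (Fin 2) ℂ) 0 0).re with ha
  set d := ((Θ : Matrix (Fin 2) (Fin 2) ℂ) 1 1).re with hd
  set b := ((Θ : Matrix (Fin 2) (Fin 2) ℂ) 0 1) with hb
  let κ := √(b.re ^ 2 - a * d)
  have hκ : κ ^ 2 = b.re ^ 2 - a * d := Real.sq_sqrt (by linarith)
  have hκ0 : 0 < κ := Real.sqrt_pos.2 (by linarith)
  let S : Matrix (Fin 2) (Fin 2) ℝ := !![d, b.re + κ; -(b.re + κ), -a]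
  have hS : S.det = 2 * κ * (κ + b.re) := by
    rw [Matrix.det_fin_two_of]
    linear_combination -hκ
  have hdiag (i) : (Θ : Matrix (Fin 2) (Fin 2) ℂ) i i =
      (((Θ : Matrix (Fin 2) (Fin 2) ℂ) i i).re : ℂ) :=
    (Complex.conj_eq_iff_re.1 (Θ.conj_apply i i)).symm
  refine ⟨S, by rw [hS]; positivity, _, ?_, eq_antidiag_iff.2 ⟨?_, ?_, rfl⟩⟩
  all_goals
    rw [congruence_apply, hdiag 0, hdiag 1, ← Θ.conj_apply 0 1, ← ha, ← hd, ← hb]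
    simp [S]
  · nlinarith [mul_pos (mul_pos hκ0 hκ0) (show 0 < κ + b.re by positivity)]
  · linear_combination d * hκ
  · linear_combination a * hκ

lemma IsOneDimensional.exists_normalForm {Φ Ψ : Herm (Fin 2)}
    (hΦ : (Φ : Matrix (Fin 2) (Fin 2) ℂ).det ≠ 0) (hC : IsOneDimensional Φ Ψ) :
    ∃ (T : Matrix (Fin 2) (Fin 2) ℂ) (c : ℝ), T.det ≠ 0 ∧ c ≠ 0 ∧
      congruence T Φ = antidiag (c * Complex.I) ∧
      ((∀ μ ν, quadForm Φ μ ν = 0 → quadForm Ψ μ ν ≤ 0) ∨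
        ∃ z : ℂ, z.re < 0 ∧ congruence T Ψ = antidiag z) := by
  obtain ⟨T, c, hT, hc, hΦT, h0, h1, h01⟩ := hC.exists_congruence_eq_antidiag_mul_I hΦ
  by_cases hdet : ((congruence T Ψ : Matrix (Fin 2) (Fin 2) ℂ) 0 1).re ^ 2 ≤
      quadForm (congruence T Ψ) 1 0 * quadForm (congruence T Ψ) 0 1
  · refine ⟨T, c, hT, hc, hΦT, Or.inl fun μ ν h => ?_⟩
    obtain ⟨α, β, rfl, rfl⟩ := exists_eq_combination hT μ ν
    simp only [smul_eq_mul] at h ⊢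
    rw [← quadForm_congruence, hΦT, quadForm_antidiag_mul_I] at h
    rw [← quadForm_congruence]
    exact quadForm_nonpos_of_im_eq_zero h0 h1 hdet (by simpa [hc] using h)
  · obtain ⟨S, hS, z, hz, hΨS⟩ := exists_real_congruence_eq_antidiag h01 (not_le.1 hdet)
    refine ⟨T * S.map Complex.ofReal, S.det * c, ?_, mul_ne_zero hS hc, ?_, Or.inr ⟨z, hz, ?_⟩⟩
    · rw [Matrix.det_mul]
      have : (S.map Complex.ofReal).det = S.det := (Complex.ofRealHom.map_det S).symm
      rw [this]
      exact mul_ne_zero hT (Complex.ofReal_ne_zero.2 hS)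
    · rw [congruence_mul, hΦT, congruence_antidiag_mul_I]
    · rw [congruence_mul, hΨS]

end NormalForm

/-! ### The gauge -/

section MinkowskiGauge

variable {V : Type*} [AddCommGroup V] [Module ℝ V] {C : Set V}

lemma minkowskiGauge_smul_le {t : ℝ} (ht : 0 ≤ t) {x : V} (hx : x ∈ C) :
    minkowskiGauge C (t • x) ≤ t :=
  iInf₂_le t ⟨ht, x, hx, rfl⟩

lemma minkowskiGauge_lt_iff {x : V} {b : EReal} :
    minkowskiGauge C x < b ↔ ∃ t : ℝ, (0 ≤ t ∧ ∃ y ∈ C, x = t • y) ∧ (t : EReal) < b := by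
  simp only [minkowskiGauge, iInf_lt_iff, exists_prop]

lemma le_minkowskiGauge (l : V →ₗ[ℝ] ℝ) (hl : ∀ y ∈ C, l y ≤ 1) (x : V) :
    (l x : EReal) ≤ minkowskiGauge C x := by
  refine le_iInf₂ fun t ⟨ht, y, hy, hxy⟩ => EReal.coe_le_coe_iff.2 ?_
  rw [hxy, map_smul, smul_eq_mul]
  exact mul_le_of_le_one_right ht (hl y hy)

lemma minkowskiGauge_nonneg (x : V) : 0 ≤ minkowskiGauge C x :=
  le_minkowskiGauge 0 (fun _ _ => zero_le_one) x

lemma minkowskiGauge_eq_top {K : PointedCone ℝ V} (hCK : C ⊆ K) {x : V} (hx : x ∉ K) :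
    minkowskiGauge C x = ⊤ :=
  iInf₂_eq_top.2 fun _ ⟨ht, _, hy, hxy⟩ => (hx (hxy ▸ K.smul_mem ht (hCK hy))).elim

lemma minkowskiGauge_add_le (hC : Convex ℝ C) (x y : V) :
    minkowskiGauge C (x + y) ≤ minkowskiGauge C x + minkowskiGauge C y := by
  have hbot (z : V) : minkowskiGauge C z ≠ ⊥ :=
    (EReal.bot_lt_zero.trans_le (minkowskiGauge_nonneg z)).ne'
  refine EReal.le_add_of_forall_gt (.inl (hbot x)) (.inr (hbot y)) fun a hxa b hyb => ?_
  obtain ⟨s, ⟨hs, u, hu, rfl⟩, hsa⟩ := minkowskiGauge_lt_iff.1 hxa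
  obtain ⟨t, ⟨ht, v, hv, rfl⟩, htb⟩ := minkowskiGauge_lt_iff.1 hyb
  obtain ⟨w, hw, hadd⟩ := hC.exists_mem_add_smul_eq hu hv hs ht
  calc minkowskiGauge C (s • u + t • v)
      ≤ ((s + t : ℝ) : EReal) := hadd ▸ minkowskiGauge_smul_le (add_nonneg hs ht) hw
    _ ≤ a + b := by
        rw [EReal.coe_add]
        exact add_le_add hsa.le htb.le

lemma minkowskiGauge_sum_le (hC : Convex ℝ C) (hne : C.Nonempty) {ι : Type*} (s : Finset ι)
    {x : ι → V} {t : ι → ℝ} (h : ∀ i ∈ s, minkowskiGauge C (x i) ≤ t i) :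
    minkowskiGauge C (∑ i ∈ s, x i) ≤ (∑ i ∈ s, t i : ℝ) := by
  classical
  induction s using Finset.induction_on with
  | empty =>
    obtain ⟨y, hy⟩ := hne
    simpa using minkowskiGauge_smul_le le_rfl hy
  | insert i s hi ih =>
    rw [Finset.sum_insert hi, Finset.sum_insert hi, EReal.coe_add]
    exact (minkowskiGauge_add_le hC _ _).trans (add_le_add (h i (Finset.mem_insert_self i s))
      (ih fun j hj => h j (Finset.mem_insert_of_mem hj)))

end MinkowskiGauge

section SymGauge

variable {p n q : Type*} [Fintype n] [Fintype q] {Φ Ψ : Herm (Fin 2)}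

lemma ofReal_mem_curve_congruence {T : Matrix (Fin 2) (Fin 2) ℂ} {c : ℝ}
    (hΦT : congruence T Φ = antidiag (c * Complex.I)) {t : ℝ}
    (hΨ : quadForm (congruence T Ψ) t 1 ≤ 0) :
    ((t : ℂ), 1) ∈ curve (congruence T Φ) (congruence T Ψ) :=
  ⟨by simp, by simp [hΦT, quadForm_antidiag_mul_I], hΨ⟩

lemma infty_mem_curve_congruence {T : Matrix (Fin 2) (Fin 2) ℂ} {c : ℝ}
    (hΦT : congruence T Φ = antidiag (c * Complex.I))
    (hΨ : quadForm (congruence T Ψ) 1 0 ≤ 0) :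
    (1, 0) ∈ curve (congruence T Φ) (congruence T Ψ) :=
  ⟨by simp, by simp [hΦT, quadForm_antidiag_mul_I], hΨ⟩

lemma quadForm_congruence_nonpos_of_redundant
    (h : ∀ μ ν, quadForm Φ μ ν = 0 → quadForm Ψ μ ν ≤ 0) (T : Matrix (Fin 2) (Fin 2) ℂ) (α β : ℂ)
    (hΦ : quadForm (congruence T Φ) α β = 0) : quadForm (congruence T Ψ) α β ≤ 0 := by
  rw [quadForm_congruence] at hΦ ⊢
  exact h _ _ hΦ

lemma mul_mul_conjTranspose_comm_of_pencilMap_eq_zero {c : ℝ} (hc : c ≠ 0) {C D : Matrix p n ℂ}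
    {X : Herm n} (h : pencilMap (antidiag (c * Complex.I)) C D X = 0) :
    D * (X : Matrix n n ℂ) * Cᴴ = C * (X : Matrix n n ℂ) * Dᴴ := by
  have hcI : (c * Complex.I : ℂ) ≠ 0 := by simp [hc]
  have hstar : star (c * Complex.I : ℂ) = -(c * Complex.I) := by simp
  rw [pencilMap_antidiag, hstar, neg_smul, neg_add_eq_zero] at h
  exact (smul_right_injective _ hcI h).symm

lemma posSemidef_mul_mul_conjTranspose_of_pencilMap_nonpos {z : ℂ} (hz : z.re < 0)
    {C D : Matrix p n ℂ} {X : Herm n}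
    (hDC : D * (X : Matrix n n ℂ) * Cᴴ = C * (X : Matrix n n ℂ) * Dᴴ)
    (h : (-pencilMap (antidiag z) C D X).PosSemidef) :
    (C * (X : Matrix n n ℂ) * Dᴴ).PosSemidef := by
  have hpos : 0 < -(2 * z.re) := by linarith
  have heq : -pencilMap (antidiag z) C D X =
      ((-(2 * z.re) : ℝ) : ℂ) • (C * (X : Matrix n n ℂ) * Dᴴ) := by
    rw [pencilMap_antidiag, hDC, ← add_smul, ← neg_smul]
    congr 1
    apply Complex.ext <;> simp
    ring
  rw [heq] at h
  have := h.smul (a := (((-(2 * z.re))⁻¹ : ℝ) : ℂ)) (by exact_mod_cast (inv_pos.2 hpos).le)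
  rwa [smul_smul, ← Complex.ofReal_mul, inv_mul_cancel₀ hpos.ne', Complex.ofReal_one,
    one_smul] at this

/-- In the coordinates of the normal form, this is the joint diagonalization of `C X Dᴴ`
and `D X Dᴴ`. -/
theorem exists_sum_dyad_of_primalFeasible [Finite p]
    (hΦ : (Φ : Matrix (Fin 2) (Fin 2) ℂ).det ≠ 0) (hC : IsOneDimensional Φ Ψ)
    {F G : Matrix p n ℂ} {X : Herm n} (hX : PrimalFeasible Φ Ψ F G X) :
    ∃ (r : ℕ) (a : Fin r → n → ℂ), X = ∑ k, dyad (a k) ∧ ∀ k, a k ∈ dict Φ Ψ F G := by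
  obtain ⟨T, c, hT, hc, hΦT, hΨT⟩ := hC.exists_normalForm hΦ
  obtain ⟨C, D, rfl, rfl⟩ := exists_eq_combination hT F G
  obtain ⟨hpsd, hXΦ, hXΨ⟩ := hX
  rw [pencilMap_congruence] at hXΦ hXΨ
  have hDC := mul_mul_conjTranspose_comm_of_pencilMap_eq_zero hc (hΦT ▸ hXΦ)
  obtain ⟨r, a, hXa, ha⟩ := exists_sum_dyad_diagonal hpsd hDC
  refine ⟨r, a, hXa, fun k => dict_congruence_subset hT Φ Ψ C D ?_⟩
  rcases ha k with h0 | ⟨t, ht, hpos⟩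
  · refine ⟨(1, 0), infty_mem_curve_congruence hΦT ?_, by simp [h0]⟩
    rcases hΨT with hred | ⟨z, -, hz⟩
    · exact quadForm_congruence_nonpos_of_redundant hred _ _ _
        (by simp [hΦT, quadForm_antidiag_mul_I])
    · simp [hz, quadForm_antidiag]
  · refine ⟨(t, 1), ofReal_mem_curve_congruence hΦT ?_, by
      simp [Matrix.sub_mulVec, Matrix.smul_mulVec, ht]⟩
    rcases hΨT with hred | ⟨z, hz0, hz⟩
    · exact quadForm_congruence_nonpos_of_redundant hred _ _ _
        (by simp [hΦT, quadForm_antidiag_mul_I])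
    · have ht0 : 0 ≤ t :=
        hpos (posSemidef_mul_mul_conjTranspose_of_pencilMap_nonpos hz0 hDC (hz ▸ hXΨ))
      have := mul_nonpos_of_nonpos_of_nonneg hz0.le ht0
      simp only [hz, quadForm_antidiag, one_mul, Complex.star_def, Complex.conj_ofReal,
        Complex.re_mul_ofReal]
      linarith

lemma atoms_subset_feasibleCone [Finite p] (F G : Matrix p n ℂ) (E : Matrix q n ℂ) :
    atoms Φ Ψ F G E ⊆ feasibleCone Φ Ψ F G := by
  rintro _ ⟨a, ha, -, rfl⟩
  exact dyad_mem_feasibleCone ha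

lemma trInner_gram_le_one_of_mem_convexHull_atoms {F G : Matrix p n ℂ} {E : Matrix q n ℂ}
    {X : Herm n} (hX : X ∈ convexHull ℝ (atoms Φ Ψ F G E)) : trInner X (gram E) ≤ 1 := by
  refine convexHull_min (t := {X | (trForm.flip (gram E)) X ≤ 1}) ?_
    (convex_halfSpace_le (trForm.flip (gram E)).isLinear 1) hX
  rintro _ ⟨a, -, ha, rfl⟩
  simp only [Set.mem_ofPred_eq, LinearMap.flip_apply, trForm_apply]
  rw [trInner_dyad, herForm_gram]
  exact pow_le_one₀ (norm_nonneg _) ha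

lemma symGauge_dyad_le {F G : Matrix p n ℂ} (E : Matrix q n ℂ) {a : n → ℂ}
    (ha : a ∈ dict Φ Ψ F G) : symGauge Φ Ψ F G E (dyad a) ≤ normSqE E a := by
  refine EReal.le_of_forall_lt_iff_le.1 fun z hz => ?_
  have hlt : normSqE E a < z := EReal.coe_lt_coe_iff.1 hz
  have hz0 : 0 < z := (sq_nonneg _).trans_lt hlt
  have hsq : (√z)⁻¹ ^ 2 = z⁻¹ := by rw [inv_pow, Real.sq_sqrt hz0.le]
  have hmem : dyad ((((√z)⁻¹ : ℝ) : ℂ) • a) ∈ atoms Φ Ψ F G E := by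
    refine ⟨_, smul_mem_dict _ ha, (sq_le_one_iff₀ (norm_nonneg _)).1 ?_, rfl⟩
    rw [← normSqE, normSqE_smul, Complex.norm_real, Real.norm_eq_abs, sq_abs, hsq,
      inv_mul_le_one₀ hz0]
    exact hlt.le
  have hdyad : dyad a = z • dyad ((((√z)⁻¹ : ℝ) : ℂ) • a) := by
    rw [dyad_smul, hsq, smul_smul, mul_inv_cancel₀ hz0.ne', one_smul]
  rw [hdyad]
  exact minkowskiGauge_smul_le hz0.le (subset_convexHull ℝ _ hmem)

lemma IsOneDimensional.nonempty_atoms (hC : IsOneDimensional Φ Ψ) (F G : Matrix p n ℂ)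
    (E : Matrix q n ℂ) : (atoms Φ Ψ F G E).Nonempty :=
  let ⟨x, hx, _⟩ := hC
  ⟨dyad 0, 0, ⟨x, hx, Matrix.mulVec_zero _⟩, by simp, rfl⟩

theorem symGauge_eq [Finite p] (hΦ : (Φ : Matrix (Fin 2) (Fin 2) ℂ).det ≠ 0)
    (hC : IsOneDimensional Φ Ψ) {F G : Matrix p n ℂ} (E : Matrix q n ℂ) {X : Herm n}
    (hX : PrimalFeasible Φ Ψ F G X) : symGauge Φ Ψ F G E X = (trInner X (gram E) : ℝ) := by
  apply le_antisymm
  · obtain ⟨r, a, rfl, ha⟩ := exists_sum_dyad_of_primalFeasible hΦ hC hX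
    simp only [trInner_sum_dyad, herForm_gram]
    exact minkowskiGauge_sum_le (convex_convexHull ℝ _)
      (hC.nonempty_atoms F G E).convexHull _ fun k _ => symGauge_dyad_le E (ha k)
  · exact le_minkowskiGauge (trForm.flip (gram E))
      (fun _ hY => trInner_gram_le_one_of_mem_convexHull_atoms hY) X

theorem symGauge_eq_top [Finite p] {F G : Matrix p n ℂ} (E : Matrix q n ℂ) {X : Herm n}
    (hX : ¬ PrimalFeasible Φ Ψ F G X) : symGauge Φ Ψ F G E X = ⊤ :=
  minkowskiGauge_eq_top
    (convexHull_min (atoms_subset_feasibleCone F G E) (feasibleCone Φ Ψ F G).convex)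
    (mem_feasibleCone.not.2 hX)

end SymGauge

/-! ### Strict feasibility -/

section Pencil

variable {K V W : Type*} [Field K] [AddCommGroup V] [Module K V] [AddCommGroup W] [Module K W]

lemma exists_not_injective_pencil [IsAlgClosed K] [FiniteDimensional K V] [FiniteDimensional K W]
    [Nontrivial V] (hVW : Module.finrank K V = Module.finrank K W) (S T : V →ₗ[K] W) :
    ∃ μ ν : K, (μ, ν) ≠ (0, 0) ∧ ¬ Function.Injective (μ • S - ν • T) := by
  by_cases hS : Function.Injective S
  · let e := LinearEquiv.ofInjectiveOfFinrankEq S hS hVW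
    obtain ⟨τ, hτ⟩ := Module.End.exists_eigenvalue (e.symm.toLinearMap ∘ₗ T)
    obtain ⟨u, hu⟩ := hτ.exists_hasEigenvector
    have hTu : T u = τ • S u := by
      have := congrArg e hu.apply_eq_smul
      rwa [LinearMap.comp_apply, LinearEquiv.coe_coe, LinearEquiv.apply_symm_apply,
        map_smul] at this
    refine ⟨τ, 1, by simp, fun hinj => hu.2 (hinj ?_)⟩
    simp [hTu]
  · exact ⟨1, 0, by simp, by simpa using hS⟩

lemma le_comap_map_iSup_ker_pencil (S T : V →ₗ[K] W) {ι : Type*} {x : ι → K × K} {s : Set ι}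
    {y : K × K} (hy : ∀ i ∈ s, y.1 * (x i).2 ≠ y.2 * (x i).1) (μ ν : K) :
    ⨆ i ∈ s, LinearMap.ker ((x i).1 • S - (x i).2 • T) ≤
      ((⨆ i ∈ s, LinearMap.ker ((x i).1 • S - (x i).2 • T)).map (y.1 • S - y.2 • T)).comap
        (μ • S - ν • T) := by
  refine iSup₂_le fun i hi a ha => ?_
  have hδ : y.1 * (x i).2 - y.2 * (x i).1 ≠ 0 := sub_ne_zero.2 (hy i hi)
  have ha0 : (x i).1 • S a - (x i).2 • T a = 0 := ha
  refine ⟨((y.1 * (x i).2 - y.2 * (x i).1)⁻¹ * (μ * (x i).2 - ν * (x i).1)) • a,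
    Submodule.smul_mem _ _ (Submodule.mem_iSup_of_mem i (Submodule.mem_iSup_of_mem hi ha)), ?_⟩
  rw [map_smul, mul_smul, inv_smul_eq_iff₀ hδ, ← sub_eq_zero]
  simp only [LinearMap.sub_apply, LinearMap.smul_apply]
  linear_combination (norm := module) (μ * y.2 - ν * y.1) • ha0

/-- Otherwise the induced pencil `V ⧸ V' → W ⧸ W'` would be invertible everywhere, whereas its
determinant has a zero. -/
lemma eq_top_of_forall_le_comap_map_pencil [IsAlgClosed K] [FiniteDimensional K V]
    [FiniteDimensional K W] {S T : V →ₗ[K] W}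
    (hsurj : ∀ μ ν : K, (μ, ν) ≠ (0, 0) → Function.Surjective (μ • S - ν • T)) {y : K × K}
    (hy : y ≠ 0) {V' : Submodule K V} (hker : LinearMap.ker (y.1 • S - y.2 • T) ≤ V')
    (hmap : ∀ μ ν : K, V' ≤ (V'.map (y.1 • S - y.2 • T)).comap (μ • S - ν • T)) : V' = ⊤ := by
  by_contra hne
  have : Nontrivial (V ⧸ V') := Submodule.Quotient.nontrivial_iff.2 hne
  set W' := V'.map (y.1 • S - y.2 • T)
  let S' : V ⧸ V' →ₗ[K] W ⧸ W' := V'.mapQ W' S (by simpa using hmap 1 0)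
  let T' : V ⧸ V' →ₗ[K] W ⧸ W' := V'.mapQ W' T (by simpa using hmap 0 (-1))
  have hmk (μ ν : K) (v : V) : (μ • S' - ν • T') (V'.mkQ v) = W'.mkQ ((μ • S - ν • T) v) := by
    simp [S', T']
  have hsurj' (μ ν : K) (h : (μ, ν) ≠ (0, 0)) : Function.Surjective (μ • S' - ν • T') := by
    intro w
    obtain ⟨w, rfl⟩ := W'.mkQ_surjective w
    obtain ⟨v, rfl⟩ := hsurj μ ν h w
    exact ⟨V'.mkQ v, hmk μ ν v⟩
  have hinj : Function.Injective (y.1 • S' - y.2 • T') := by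
    rw [← LinearMap.ker_eq_bot, LinearMap.ker_eq_bot']
    intro v hv
    obtain ⟨v, rfl⟩ := V'.mkQ_surjective v
    rw [hmk, Submodule.mkQ_apply, Submodule.Quotient.mk_eq_zero] at hv
    obtain ⟨u, hu, huv⟩ := hv
    rw [Submodule.mkQ_apply, Submodule.Quotient.mk_eq_zero, ← sub_add_cancel v u]
    exact V'.add_mem (hker (by rw [LinearMap.mem_ker, map_sub, huv, sub_self])) hu
  have hfinrank : Module.finrank K (V ⧸ V') = Module.finrank K (W ⧸ W') :=
    (LinearEquiv.ofBijective _ ⟨hinj, hsurj' y.1 y.2 hy⟩).finrank_eq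
  obtain ⟨μ, ν, hμν, hnot⟩ := exists_not_injective_pencil hfinrank S' T'
  exact hnot ((LinearMap.injective_iff_surjective_of_finrank_eq_finrank hfinrank).2
    (hsurj' μ ν hμν))

theorem iSup_ker_pencil_eq_top [IsAlgClosed K] [FiniteDimensional K V] [FiniteDimensional K W]
    {S T : V →ₗ[K] W}
    (hsurj : ∀ μ ν : K, (μ, ν) ≠ (0, 0) → Function.Surjective (μ • S - ν • T))
    {ι : Type*} [Infinite ι] {x : ι → K × K} (hx0 : ∀ i, x i ≠ 0)
    (hx : Pairwise fun i j => (x i).1 * (x j).2 ≠ (x i).2 * (x j).1) :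
    ⨆ i, LinearMap.ker ((x i).1 • S - (x i).2 • T) = ⊤ := by
  obtain ⟨s, hs⟩ := CompleteLattice.IsCompactElement.exists_finset_of_le_iSup _
    ((Submodule.fg_iff_compact _).1 (IsNoetherian.noetherian _))
    (fun i => LinearMap.ker ((x i).1 • S - (x i).2 • T)) le_rfl
  obtain ⟨j, hj⟩ := Infinite.exists_notMem_finset s
  have htop : ⨆ i ∈ (s : Set ι), LinearMap.ker ((x i).1 • S - (x i).2 • T) = ⊤ :=
    eq_top_of_forall_le_comap_map_pencil hsurj (hx0 j)
      ((le_iSup (fun i => LinearMap.ker ((x i).1 • S - (x i).2 • T)) j).trans hs)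
      (le_comap_map_iSup_ker_pencil S T fun i hi => hx (ne_of_mem_of_not_mem hi hj).symm)
  exact top_le_iff.1 (htop.ge.trans (iSup₂_le_iSup (· ∈ (s : Set ι)) _))

end Pencil

section Slater

lemma posDef_sum_smul_dyad {n : Type*} [Finite n] {ι : Type*} (s : Finset ι) {v : ι → n → ℂ}
    {w : ι → ℝ} (hw : ∀ i ∈ s, 0 < w i) (hv : Submodule.span ℂ (v '' s) = ⊤) :
    ((∑ i ∈ s, w i • dyad (v i) : Herm n) : Matrix n n ℂ).PosDef := by
  cases nonempty_fintype n
  refine posDef_iff_herForm.2 fun b hb => ?_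
  have hform : herForm (∑ i ∈ s, w i • dyad (v i)) b = ∑ i ∈ s, w i * ‖star (v i) ⬝ᵥ b‖ ^ 2 := by
    rw [← trInner_dyad, ← trForm_apply, map_sum]
    simp only [map_smul, trForm_apply, trInner_dyad, herForm_dyad, smul_eq_mul]
  rw [hform]
  refine (Finset.sum_nonneg fun i hi => mul_nonneg (hw i hi).le (sq_nonneg _)).lt_of_ne' fun h0 =>
    hb ?_
  rw [Finset.sum_eq_zero_iff_of_nonneg fun i hi => mul_nonneg (hw i hi).le (sq_nonneg _)] at h0
  have hzero : dotProductBilin ℂ ℂ (star b) = 0 := by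
    refine LinearMap.ext_on hv ?_
    rintro _ ⟨i, hi, rfl⟩
    have : star (v i) ⬝ᵥ b = 0 := by simpa [(hw i hi).ne'] using h0 i hi
    change star b ⬝ᵥ v i = 0
    rw [Matrix.star_dotProduct, this, star_zero]
  exact dotProduct_star_self_eq_zero.1 (LinearMap.congr_fun hzero b)

lemma span_image_eq_top_of_eq_smul {R V W : Type*} [Semiring R] [AddCommMonoid V] [Module R V]
    [AddCommMonoid W] [Module R W] {f : V →ₗ[R] W} (hf : Function.Surjective f) {s : Set V}
    (hs : Submodule.span R s = ⊤) {v : V → W} {c : V → R} (hv : ∀ a ∈ s, f a = c a • v a) :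
    Submodule.span R (v '' s) = ⊤ := by
  rw [← top_le_iff, ← LinearMap.range_eq_top.2 hf, LinearMap.range_eq_map, ← hs,
    Submodule.map_span_le]
  intro a ha
  rw [hv a ha]
  exact Submodule.smul_mem _ _ (Submodule.subset_span ⟨a, ha, rfl⟩)

variable {p n : Type*} [Fintype p] [Fintype n]

lemma FullRowRank.surjective {F G : Matrix p n ℂ} (h : FullRowRank F G) {μ ν : ℂ}
    (hx : (μ, ν) ≠ (0, 0)) : Function.Surjective (μ • G - ν • F).mulVecLin := by
  rw [← LinearMap.range_eq_top]
  apply Submodule.eq_top_of_finrank_eq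
  rw [Module.finrank_fintype_fun_eq_card]
  exact h μ ν hx

/-- A sum of dyads `a aᴴ` over a spanning set of kernel vectors `a` of the pencil at the
points `x i`. -/
theorem FullRowRank.exists_posDef {F G : Matrix p n ℂ} (h : FullRowRank F G) {ι : Type*}
    [Infinite ι] {x : ι → ℂ × ℂ} (hx0 : ∀ i, x i ≠ 0)
    (hx : Pairwise fun i j => (x i).1 * (x j).2 ≠ (x i).2 * (x j).1) :
    ∃ X : Herm n, (X : Matrix n n ℂ).PosDef ∧
      (∀ Θ, (∀ i, quadForm Θ (x i).1 (x i).2 = 0) → pencilHerm Θ F G X = 0) ∧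
      ∀ Θ, (∀ i, quadForm Θ (x i).1 (x i).2 < 0) →
        ((-pencilHerm Θ F G X : Herm p) : Matrix p p ℂ).PosDef := by
  have hpencil (μ ν : ℂ) :
      μ • G.mulVecLin - ν • F.mulVecLin = (μ • G - ν • F).mulVecLin := by
    simp
  have hspan := iSup_ker_pencil_eq_top (S := G.mulVecLin) (T := F.mulVecLin)
    (fun μ ν hμν => hpencil μ ν ▸ h.surjective hμν) hx0 hx
  simp only [hpencil] at hspan
  rw [Submodule.iSup_eq_span] at hspan
  obtain ⟨s, hs, hs_span⟩ := (Submodule.fg_span_iff_fg_span_finset_subset _).1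
    (IsNoetherian.noetherian (Submodule.span ℂ
      (⋃ i, (LinearMap.ker ((x i).1 • G - (x i).2 • F).mulVecLin : Set (n → ℂ)))))
  rw [hspan, eq_comm] at hs_span
  have hker (a) (ha : a ∈ s) : ∃ i v, F *ᵥ a = (x i).1 • v ∧ G *ᵥ a = (x i).2 • v := by
    obtain ⟨i, hi⟩ := Set.mem_iUnion.1 (hs ha)
    exact ⟨i, exists_mulVec_eq_smul (hx0 i) hi⟩
  choose! i v hF hG using hker
  have hF_surj : Function.Surjective F.mulVecLin := by
    simpa using h.surjective (μ := 0) (ν := -1) (by simp)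
  have hv : Submodule.span ℂ (v '' s) = ⊤ := span_image_eq_top_of_eq_smul hF_surj hs_span hF
  refine ⟨∑ a ∈ s, dyad a, ?_, fun Θ hΘ => ?_, fun Θ hΘ => ?_⟩
  · simpa using posDef_sum_smul_dyad s (v := id) (w := 1) (fun _ _ => one_pos) (by simpa)
  · rw [map_sum]
    refine Finset.sum_eq_zero fun a ha => ?_
    rw [pencilHerm_dyad Θ (hF a ha) (hG a ha), hΘ, zero_smul]
  · have hsum : -pencilHerm Θ F G (∑ a ∈ s, dyad a) =
        ∑ a ∈ s, (-quadForm Θ (x (i a)).1 (x (i a)).2) • dyad (v a) := by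
      rw [map_sum, ← Finset.sum_neg_distrib]
      exact Finset.sum_congr rfl fun a ha => by
        rw [pencilHerm_dyad Θ (hF a ha) (hG a ha), neg_smul]
    rw [hsum]
    exact posDef_sum_smul_dyad s (fun a _ => neg_pos.2 (hΘ _)) hv

end Slater

/-! ### Linear matrix inequalities -/

section Farkas

/-- Farkas' lemma with Slater's condition at `x₀`: by the Riesz extension theorem, the restriction
of `w` to `ker L` extends to a form that is nonnegative on the cone. -/
lemma exists_nonneg_add_comp {V U : Type*} [AddCommGroup V] [Module ℝ V] [AddCommGroup U]
    [Module ℝ U] {K : PointedCone ℝ V} {L : V →ₗ[ℝ] U} {w : V →ₗ[ℝ] ℝ}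
    (hw : ∀ x ∈ K, L x = 0 → 0 ≤ w x) {x₀ : V} (hLx₀ : L x₀ = 0)
    (hx₀ : ∀ y, ∃ t : ℝ, t • x₀ + y ∈ K) :
    ∃ k : U →ₗ[ℝ] ℝ, ∀ x ∈ K, 0 ≤ w x + k (L x) := by
  obtain ⟨g, hgw, hg⟩ := riesz_extension K ⟨LinearMap.ker L, w.domRestrict _⟩
    (fun x hx => hw x hx x.2) fun y => by
      obtain ⟨t, ht⟩ := hx₀ y
      exact ⟨⟨t • x₀, by simp [hLx₀]⟩, ht⟩
  have hgw' : g - w ∈ LinearMap.range L.dualMap := by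
    rw [LinearMap.range_dualMap_eq_dualAnnihilator_ker, Submodule.mem_dualAnnihilator]
    exact fun x hx => sub_eq_zero.2 (hgw ⟨x, hx⟩)
  obtain ⟨k, hk⟩ := hgw'
  refine ⟨k, fun x hx => ?_⟩
  have hkx : k (L x) = g x - w x := LinearMap.congr_fun hk x
  rw [hkx, add_sub_cancel]
  exact hg x hx

end Farkas

section Duality

variable {p n q : Type*}

lemma continuous_herForm [Fintype n] (Z : Herm n) : Continuous (herForm Z) := by
  unfold herForm
  fun_prop

/-- The constant is the maximum of `-aᴴ Y a / aᴴ X a` over the compact unit sphere. -/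
lemma exists_forall_ge_smul_add_mem_psdCone [Finite n] {X : Herm n} (hX : (X : Matrix n n ℂ).PosDef)
    (Y : Herm n) : ∃ t : ℝ, ∀ s ≥ t, s • X + Y ∈ psdCone n := by
  cases nonempty_fintype n
  rw [posDef_iff_herForm] at hX
  have hcont : ContinuousOn (fun a => -herForm Y a / herForm X a) (Metric.sphere (0 : n → ℂ) 1) :=
    (continuous_herForm Y).neg.continuousOn.div (continuous_herForm X).continuousOn fun a ha =>
      (hX a (ne_zero_of_mem_unit_sphere ⟨a, ha⟩)).ne'
  obtain ⟨t, ht⟩ := (isCompact_sphere (0 : n → ℂ) 1).bddAbove_image hcont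
  refine ⟨t, fun s hs => posSemidef_iff_herForm.2 fun a => ?_⟩
  obtain rfl | ha := eq_or_ne a 0
  · simp [herForm]
  set u : n → ℂ := (‖a‖ : ℂ)⁻¹ • a
  have hu : u ∈ Metric.sphere (0 : n → ℂ) 1 := by
    simp [u, norm_smul, norm_ne_zero_iff.2 ha]
  have hau : a = (‖a‖ : ℂ) • u := by
    rw [smul_inv_smul₀ (Complex.ofReal_ne_zero.2 (norm_ne_zero_iff.2 ha))]
  have hXu := hX u (ne_zero_of_mem_unit_sphere ⟨u, hu⟩)
  have hYu : -herForm Y u ≤ t * herForm X u :=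
    (div_le_iff₀ hXu).1 (ht (Set.mem_image_of_mem _ hu))
  rw [hau, herForm_smul_right, herForm_add, herForm_smul]
  exact mul_nonneg (by positivity) (by nlinarith)

variable [Fintype n]

lemma herForm_stackHerm [Fintype p] (Θ : Herm (Fin 2)) (F G : Matrix p n ℂ) (P : Herm p)
    (a : n → ℂ) :
    herForm (stackHerm Θ F G P) a = trInner (pencilHerm Θ F G (dyad a)) P := by
  rw [← trInner_dyad, trInner_stackHerm]

variable {Φ Ψ : Herm (Fin 2)} {F G : Matrix p n ℂ} {E : Matrix q n ℂ}

lemma isCertificate_iff [Fintype p] [Fintype q] {Z : Herm n} {P Q : Herm p} :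
    IsCertificate Φ Ψ F G E Z P Q ↔ Q ∈ psdCone p ∧ ∀ a, herForm Z a ≤ normSqE E a +
      trInner (pencilHerm Φ F G (dyad a)) P + trInner (pencilHerm Ψ F G (dyad a)) Q := by
  have hZ := posSemidef_iff_herForm
    (Z := gram E - (Z - (stackHerm Φ F G P + stackHerm Ψ F G Q)))
  rw [IsCertificate, Matrix.mul_add, Matrix.add_mul]
  refine and_congr Iff.rfl (hZ.trans (forall_congr' fun a => ?_))
  simp only [herForm_sub, herForm_add, herForm_stackHerm, herForm_gram]
  constructor <;> intro h <;> linarith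

lemma LMIFeasible.boundedOnDict [Fintype p] [Fintype q] {Z : Herm n}
    (h : LMIFeasible Φ Ψ F G E Z) : BoundedOnDict Φ Ψ F G E Z := by
  obtain ⟨P, Q, hPQ⟩ := h
  obtain ⟨hQ, hZ⟩ := isCertificate_iff.1 hPQ
  rintro a ⟨x, ⟨hx0, hxΦ, hxΨ⟩, hxa⟩
  obtain ⟨s, hF, hG⟩ := exists_mulVec_eq_smul hx0 hxa
  have hΨQ : quadForm Ψ x.1 x.2 * herForm Q s ≤ 0 :=
    mul_nonpos_of_nonpos_of_nonneg hxΨ (posSemidef_iff_herForm.1 hQ s)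
  have hZa := hZ a
  rw [pencilHerm_dyad Φ hF hG, pencilHerm_dyad Ψ hF hG, hxΦ, ← trForm_apply, ← trForm_apply,
    map_smul, map_smul, LinearMap.smul_apply, LinearMap.smul_apply, trForm_apply, trForm_apply,
    trInner_dyad, trInner_dyad, zero_smul, smul_eq_mul] at hZa
  linarith

lemma BoundedOnDict.trInner_le [Finite p] [Fintype q]
    (hΦ : (Φ : Matrix (Fin 2) (Fin 2) ℂ).det ≠ 0) (hC : IsOneDimensional Φ Ψ) {Z X : Herm n}
    (hZ : BoundedOnDict Φ Ψ F G E Z) (hX : PrimalFeasible Φ Ψ F G X) :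
    trInner X Z ≤ trInner X (gram E) := by
  obtain ⟨r, a, rfl, ha⟩ := exists_sum_dyad_of_primalFeasible hΦ hC hX
  simp only [trInner_sum_dyad, herForm_gram]
  exact Finset.sum_le_sum fun k _ => hZ _ (ha k)

lemma curve_eq_of_redundant (hR : ∀ μ ν, quadForm Φ μ ν = 0 → quadForm Ψ μ ν ≤ 0) :
    curve Φ Ψ = curve Φ 0 := by
  ext x
  refine and_congr_right fun _ => and_congr_right fun hxΦ => iff_of_true (hR _ _ hxΦ) ?_
  simp [quadForm]

/-- In the normal form of the curve, take the points `(1, 1), (2, 1), (3, 1), …`. -/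
lemma IsOneDimensional.exists_points (hΦ : (Φ : Matrix (Fin 2) (Fin 2) ℂ).det ≠ 0)
    (hC : IsOneDimensional Φ Ψ) :
    ∃ x : ℕ → ℂ × ℂ, (∀ i, x i ≠ 0) ∧
      (Pairwise fun i j => (x i).1 * (x j).2 ≠ (x i).2 * (x j).1) ∧
      (∀ i, quadForm Φ (x i).1 (x i).2 = 0) ∧
      ((∀ μ ν, quadForm Φ μ ν = 0 → quadForm Ψ μ ν ≤ 0) ∨
        ∀ i, quadForm Ψ (x i).1 (x i).2 < 0) := by
  obtain ⟨T, c, hT, -, hΦT, hΨT⟩ := hC.exists_normalForm hΦ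
  refine ⟨fun i => (T 0 0 * (i + 1 : ℝ) + T 0 1 * 1, T 1 0 * (i + 1 : ℝ) + T 1 1 * 1),
    fun i => combination_ne_zero hT (by simp), fun i j hij => ?_, fun i => ?_,
    hΨT.imp_right fun ⟨z, hz, hΨT⟩ i => ?_⟩
  · have hwedge : T.det * ((i : ℂ) - j) ≠ 0 :=
      mul_ne_zero hT (sub_ne_zero.2 (Nat.cast_injective.ne hij))
    refine sub_ne_zero.1 fun h => hwedge ?_
    rw [← h, Matrix.det_fin_two]
    push_cast
    ring
  · rw [← quadForm_congruence, hΦT, quadForm_antidiag_mul_I]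
    simp
  · rw [← quadForm_congruence, hΨT, quadForm_antidiag, one_mul, Complex.star_def,
      Complex.conj_ofReal, Complex.re_mul_ofReal]
    nlinarith [i.cast_nonneg (α := ℝ)]

lemma exists_isCertificate_zero [Fintype p] [Fintype q] {Z X₀ : Herm n}
    (hZ : ∀ X ∈ psdCone n, pencilHerm Φ F G X = 0 → trInner X Z ≤ trInner X (gram E))
    (hX₀ : (X₀ : Matrix n n ℂ).PosDef) (hΦX₀ : pencilHerm Φ F G X₀ = 0) :
    ∃ P, IsCertificate Φ Ψ F G E Z P 0 := by
  obtain ⟨k, hk⟩ := exists_nonneg_add_comp (w := trForm.flip (gram E - Z))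
    (fun X hX hΦX => by simpa using hZ X hX hΦX) hΦX₀ fun Y =>
      (exists_forall_ge_smul_add_mem_psdCone hX₀ Y).imp fun t ht => ht t le_rfl
  obtain ⟨P, rfl⟩ := trForm_surjective k
  refine ⟨P, isCertificate_iff.2 ⟨zero_mem _, fun a => ?_⟩⟩
  have hka := hk (dyad a) (Matrix.posSemidef_vecMulVec_self_star a)
  simp only [LinearMap.flip_apply, trForm_apply, trInner_sub_right, trInner_dyad, herForm_gram,
    trInner_comm P] at hka
  rw [trInner_zero_right]
  linarith

/-- The cone in Farkas' lemma consists of the pairs `(X, N)` of a positive semidefinite matrix and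
a positive semidefinite slack for the constraint `pencilHerm Ψ F G X ⪯ 0`. -/
lemma exists_isCertificate [Fintype p] [Fintype q] {Z X₀ : Herm n}
    (hZ : ∀ X ∈ feasibleCone Φ Ψ F G, trInner X Z ≤ trInner X (gram E))
    (hX₀ : (X₀ : Matrix n n ℂ).PosDef) (hΦX₀ : pencilHerm Φ F G X₀ = 0)
    (hΨX₀ : ((-pencilHerm Ψ F G X₀ : Herm p) : Matrix p p ℂ).PosDef) :
    ∃ P Q, IsCertificate Φ Ψ F G E Z P Q := by
  let fst := LinearMap.fst ℝ (Herm n) (Herm p)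
  let snd := LinearMap.snd ℝ (Herm n) (Herm p)
  let L := (pencilHerm Φ F G ∘ₗ fst).prod (pencilHerm Ψ F G ∘ₗ fst + snd)
  let K : PointedCone ℝ (Herm n × Herm p) := (psdCone n).prod (psdCone p)
  have hw : ∀ x ∈ K, L x = 0 → 0 ≤ (trForm.flip (gram E - Z) ∘ₗ fst) x := by
    rintro ⟨X, N⟩ ⟨hX, hN⟩ hL
    obtain ⟨hΦX, hΨX⟩ := Prod.mk.inj hL
    have hXN : -pencilHerm Ψ F G X = N := neg_eq_of_add_eq_zero_right hΨX
    simpa [fst] using hZ X ⟨⟨hX, hΦX⟩, by simpa [hXN] using hN⟩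
  have hLX₀ : L (X₀, -pencilHerm Ψ F G X₀) = 0 := by simp [L, fst, snd, hΦX₀]
  obtain ⟨k, hk⟩ := exists_nonneg_add_comp hw hLX₀ fun ⟨Y, N⟩ => by
    obtain ⟨t, ht⟩ := exists_forall_ge_smul_add_mem_psdCone hX₀ Y
    obtain ⟨u, hu⟩ := exists_forall_ge_smul_add_mem_psdCone hΨX₀ N
    exact ⟨max t u, ht _ (le_max_left t u), hu _ (le_max_right t u)⟩
  obtain ⟨P, hP⟩ := trForm_surjective (k ∘ₗ LinearMap.inl ℝ (Herm p) (Herm p))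
  obtain ⟨Q, hQ⟩ := trForm_surjective (k ∘ₗ LinearMap.inr ℝ (Herm p) (Herm p))
  have hkPQ (M N : Herm p) : k (M, N) = trInner P M + trInner Q N := by
    rw [← trForm_apply, ← trForm_apply, hP, hQ]
    simp [← map_add]
  refine ⟨P, Q, isCertificate_iff.2 ⟨posSemidef_iff_herForm.2 fun b => ?_, fun a => ?_⟩⟩
  · have hb := hk (0, dyad b) ⟨zero_mem _, Matrix.posSemidef_vecMulVec_self_star b⟩
    simpa [L, fst, snd, hkPQ, trInner_comm Q, trInner_dyad] using hb
  · have ha : 0 ≤ trInner (dyad a) (gram E - Z) +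
        k (pencilHerm Φ F G (dyad a), pencilHerm Ψ F G (dyad a) + 0) :=
      hk (dyad a, 0) ⟨Matrix.posSemidef_vecMulVec_self_star a, zero_mem _⟩
    rw [hkPQ, add_zero, trInner_sub_right, trInner_dyad, trInner_dyad, herForm_gram,
      trInner_comm P, trInner_comm Q] at ha
    linarith

theorem lmiFeasible_iff_boundedOnDict [Fintype p] [Fintype q]
    (hΦ : (Φ : Matrix (Fin 2) (Fin 2) ℂ).det ≠ 0) (hC : IsOneDimensional Φ Ψ)
    (h : FullRowRank F G) {Z : Herm n} :
    LMIFeasible Φ Ψ F G E Z ↔ BoundedOnDict Φ Ψ F G E Z := by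
  refine ⟨LMIFeasible.boundedOnDict, fun hZ => ?_⟩
  obtain ⟨x, hx0, hx, hxΦ, hR | hxΨ⟩ := hC.exists_points hΦ <;>
    obtain ⟨X₀, hX₀, hX₀Φ, hX₀Ψ⟩ := h.exists_posDef hx0 hx
  · rw [IsOneDimensional, curve_eq_of_redundant hR] at hC
    rw [BoundedOnDict, dict, curve_eq_of_redundant hR] at hZ
    have hZ' : ∀ X ∈ psdCone n, pencilHerm Φ F G X = 0 → trInner X Z ≤ trInner X (gram E) := by
      intro X hX hΦX
      refine BoundedOnDict.trInner_le hΦ hC hZ ⟨hX, ?_, ?_⟩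
      · rw [← coe_pencilHerm, hΦX, ZeroMemClass.coe_zero]
      · simpa [pencilMap] using Matrix.PosSemidef.zero
    obtain ⟨P, hP⟩ := exists_isCertificate_zero hZ' hX₀ (hX₀Φ Φ hxΦ)
    exact ⟨P, 0, hP⟩
  · exact exists_isCertificate (fun X hX => hZ.trInner_le hΦ hC (mem_feasibleCone.1 hX)) hX₀
      (hX₀Φ Φ hxΦ) (hX₀Ψ Ψ hxΨ)

lemma lmiFeasible_iff_of_redundant [Fintype p] [Fintype q]
    (hΦ : (Φ : Matrix (Fin 2) (Fin 2) ℂ).det ≠ 0) (hC : IsOneDimensional Φ Ψ)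
    (h : FullRowRank F G) {Z : Herm n}
    (hR : ∀ μ ν, quadForm Φ μ ν = 0 → quadForm Ψ μ ν ≤ 0) :
    LMIFeasible Φ Ψ F G E Z ↔ LMIFeasible Φ 0 F G E Z := by
  have hC₀ : IsOneDimensional Φ 0 := by rwa [IsOneDimensional, ← curve_eq_of_redundant hR]
  rw [lmiFeasible_iff_boundedOnDict hΦ hC h, lmiFeasible_iff_boundedOnDict hΦ hC₀ h,
    BoundedOnDict, BoundedOnDict, dict, dict, curve_eq_of_redundant hR]

end Duality

/-! ### The conjugate of the gauge and the dual problem -/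

section Conjugate

variable {p n q : Type*} [Fintype n] [Fintype q] {Φ Ψ : Herm (Fin 2)} {F G : Matrix p n ℂ}
  {E : Matrix q n ℂ}

lemma trInner_sub_le_conjugate (h : Herm n → EReal) (X Z : Herm n) :
    ((trInner X Z : ℝ) : EReal) - h X ≤ conjugate h Z :=
  le_iSup (fun X => ((trInner X Z : ℝ) : EReal) - h X) X

lemma conjugate_symGauge_eq_zero [Finite p] (hΦ : (Φ : Matrix (Fin 2) (Fin 2) ℂ).det ≠ 0)
    (hC : IsOneDimensional Φ Ψ) {Z : Herm n} (hZ : BoundedOnDict Φ Ψ F G E Z) :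
    conjugate (symGauge Φ Ψ F G E) Z = 0 := by
  refine le_antisymm (iSup_le fun X => ?_) ?_
  · by_cases hX : PrimalFeasible Φ Ψ F G X
    · rw [symGauge_eq hΦ hC E hX, ← EReal.coe_sub]
      exact EReal.coe_le_coe_iff.2 (sub_nonpos.2 (hZ.trInner_le hΦ hC hX))
    · rw [symGauge_eq_top E hX, EReal.sub_top]
      exact bot_le
  · have h0 := trInner_sub_le_conjugate (symGauge Φ Ψ F G E) 0 Z
    rw [symGauge_eq hΦ hC E (mem_feasibleCone.1 (zero_mem _))] at h0
    simpa [trInner_comm 0] using h0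

/-- The supremum is infinite along the ray of an atom `a aᴴ` violating the bound. -/
lemma conjugate_symGauge_eq_top {Z : Herm n} (hZ : ¬ BoundedOnDict Φ Ψ F G E Z) :
    conjugate (symGauge Φ Ψ F G E) Z = ⊤ := by
  obtain ⟨a, ha, hlt⟩ : ∃ a ∈ dict Φ Ψ F G, normSqE E a < herForm Z a := by
    simpa [BoundedOnDict] using hZ
  set δ := herForm Z a - normSqE E a
  have hδ : 0 < δ := sub_pos.2 hlt
  have hray (t : ℝ) (ht : 0 ≤ t) :
      ((t * δ : ℝ) : EReal) ≤ conjugate (symGauge Φ Ψ F G E) Z := by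
    have hnorm : ‖((√t : ℝ) : ℂ)‖ ^ 2 = t := by
      rw [Complex.norm_real, Real.norm_eq_abs, sq_abs, Real.sq_sqrt ht]
    have hgauge := symGauge_dyad_le E (smul_mem_dict ((√t : ℝ) : ℂ) ha)
    rw [normSqE_smul, hnorm] at hgauge
    refine le_trans ?_ (trInner_sub_le_conjugate _ (dyad (((√t : ℝ) : ℂ) • a)) Z)
    rw [trInner_dyad, herForm_smul_right, hnorm, mul_sub, EReal.coe_sub]
    exact EReal.sub_le_sub le_rfl hgauge
  refine EReal.eq_top_iff_forall_lt _ |>.2 fun y => ?_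
  refine lt_of_lt_of_le (EReal.coe_lt_coe_iff.2 ?_) (hray ((|y| + 1) / δ) (by positivity))
  rw [div_mul_cancel₀ _ hδ.ne']
  linarith [le_abs_self y]

lemma conjugate_symGauge_eq_zero_iff [Finite p] (hΦ : (Φ : Matrix (Fin 2) (Fin 2) ℂ).det ≠ 0)
    (hC : IsOneDimensional Φ Ψ) {Z : Herm n} :
    conjugate (symGauge Φ Ψ F G E) Z = 0 ↔ BoundedOnDict Φ Ψ F G E Z :=
  ⟨fun h0 => by_contra fun hZ => EReal.top_ne_zero ((conjugate_symGauge_eq_top hZ).symm.trans h0),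
    conjugate_symGauge_eq_zero hΦ hC⟩

lemma dualFeasible_iff_boundedOnDict_neg {Z : Herm n} :
    DualFeasible Φ Ψ F G E Z ↔ BoundedOnDict Φ Ψ F G E (-Z) := by
  simp only [DualFeasible, BoundedOnDict, herForm_neg, neg_le_iff_add_nonneg]

lemma lmiFeasible_neg_iff_dualFeasible [Fintype p]
    (hΦ : (Φ : Matrix (Fin 2) (Fin 2) ℂ).det ≠ 0) (hC : IsOneDimensional Φ Ψ)
    (h : FullRowRank F G) {Z : Herm n} :
    LMIFeasible Φ Ψ F G E (-Z) ↔ DualFeasible Φ Ψ F G E Z := by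
  rw [dualFeasible_iff_boundedOnDict_neg, lmiFeasible_iff_boundedOnDict hΦ hC h]

variable {f : Herm n → ℝ}

lemma dualValue_eq_iSup_dualFeasible [Finite p] (hΦ : (Φ : Matrix (Fin 2) (Fin 2) ℂ).det ≠ 0)
    (hC : IsOneDimensional Φ Ψ) :
    dualValue Φ Ψ F G E f = ⨆ (Z : Herm n) (_ : DualFeasible Φ Ψ F G E Z), dualObj f Z := by
  refine iSup_congr fun Z => ?_
  by_cases hZ : DualFeasible Φ Ψ F G E Z
  · rw [conjugate_symGauge_eq_zero hΦ hC (dualFeasible_iff_boundedOnDict_neg.1 hZ), sub_zero,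
      iSup_pos hZ]
  · rw [conjugate_symGauge_eq_top (mt dualFeasible_iff_boundedOnDict_neg.2 hZ), EReal.sub_top,
      iSup_neg hZ]

lemma dualValue_eq_iSup_isCertificate [Fintype p]
    (hΦ : (Φ : Matrix (Fin 2) (Fin 2) ℂ).det ≠ 0) (hC : IsOneDimensional Φ Ψ)
    (h : FullRowRank F G) :
    dualValue Φ Ψ F G E f = ⨆ (Z : Herm n) (P : Herm p) (Q : Herm p)
      (_ : IsCertificate Φ Ψ F G E (-Z) P Q), dualObj f Z := by
  rw [dualValue_eq_iSup_dualFeasible hΦ hC]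
  refine iSup_congr fun Z => ?_
  rw [← lmiFeasible_neg_iff_dualFeasible hΦ hC h]
  simp only [LMIFeasible, iSup_exists]

lemma coe_primalObj [Finite p] (hΦ : (Φ : Matrix (Fin 2) (Fin 2) ℂ).det ≠ 0)
    (hC : IsOneDimensional Φ Ψ) {r : ℕ} {a : Fin r → n → ℂ} (ha : ∀ k, a k ∈ dict Φ Ψ F G) :
    (primalObj E f a : EReal) =
      (f (∑ k, dyad (a k)) : EReal) + symGauge Φ Ψ F G E (∑ k, dyad (a k)) := by
  have hX : PrimalFeasible Φ Ψ F G (∑ k, dyad (a k)) :=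
    mem_feasibleCone.1 (sum_mem fun k _ => dyad_mem_feasibleCone (ha k))
  simp only [symGauge_eq hΦ hC E hX, primalObj, trInner_sum_dyad, herForm_gram, EReal.coe_add]

lemma primalValue_eq_iInf [Finite p] (hΦ : (Φ : Matrix (Fin 2) (Fin 2) ℂ).det ≠ 0)
    (hC : IsOneDimensional Φ Ψ) :
    primalValue Φ Ψ F G E f = ⨅ X : Herm n, ((f X : EReal) + symGauge Φ Ψ F G E X) := by
  refine le_antisymm (le_iInf fun X => ?_) (le_iInf fun r => le_iInf₂ fun a ha => ?_)
  · by_cases hX : PrimalFeasible Φ Ψ F G X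
    · obtain ⟨r, a, rfl, ha⟩ := exists_sum_dyad_of_primalFeasible hΦ hC hX
      rw [← coe_primalObj hΦ hC ha]
      exact iInf_le_of_le r (iInf₂_le a ha)
    · rw [symGauge_eq_top E hX, EReal.coe_add_top]
      exact le_top
  · rw [coe_primalObj hΦ hC ha]
    exact iInf_le _ _

lemma dualObj_le (f : Herm n → ℝ) (X Z : Herm n) : dualObj f Z ≤ (f X - trInner X Z : ℝ) := by
  rw [dualObj, EReal.neg_le, ← EReal.coe_neg, neg_sub]
  exact trInner_sub_le_conjugate (fun X => (f X : EReal)) X Z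

lemma DualFeasible.dualObj_le_primalObj {Z : Herm n} (hZ : DualFeasible Φ Ψ F G E Z) {r : ℕ}
    {a : Fin r → n → ℂ} (ha : ∀ k, a k ∈ dict Φ Ψ F G) :
    dualObj f Z ≤ primalObj E f a := by
  refine (dualObj_le f (∑ k, dyad (a k)) Z).trans (EReal.coe_le_coe_iff.2 ?_)
  have hsum : 0 ≤ ∑ k, (normSqE E (a k) + herForm Z (a k)) :=
    Finset.sum_nonneg fun k _ => hZ (a k) (ha k)
  rw [Finset.sum_add_distrib] at hsum
  rw [primalObj, trInner_sum_dyad]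
  linarith

lemma dualValue_le_primalValue [Finite p] (hΦ : (Φ : Matrix (Fin 2) (Fin 2) ℂ).det ≠ 0)
    (hC : IsOneDimensional Φ Ψ) : dualValue Φ Ψ F G E f ≤ primalValue Φ Ψ F G E f := by
  rw [dualValue_eq_iSup_dualFeasible hΦ hC]
  exact iSup₂_le fun Z hZ => le_iInf fun r => le_iInf₂ fun a ha => hZ.dualObj_le_primalObj ha

lemma DualFeasible.complementary_slackness {Z : Herm n} (hZ : DualFeasible Φ Ψ F G E Z) {r : ℕ}
    {a : Fin r → n → ℂ} (ha : ∀ k, a k ∈ dict Φ Ψ F G)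
    (h : (primalObj E f a : EReal) = dualObj f Z) :
    (f (∑ k, dyad (a k)) : EReal) + conjugate (fun X => (f X : EReal)) Z =
        ((trInner (∑ k, dyad (a k)) Z : ℝ) : EReal) ∧
      ∀ k, normSqE E (a k) + herForm Z (a k) = 0 := by
  have hnonneg : ∀ k ∈ Finset.univ, 0 ≤ normSqE E (a k) + herForm Z (a k) :=
    fun k _ => hZ (a k) (ha k)
  have hle := dualObj_le f (∑ k, dyad (a k)) Z
  rw [← h, EReal.coe_le_coe_iff, primalObj, trInner_sum_dyad] at hle
  have hsum : ∑ k, (normSqE E (a k) + herForm Z (a k)) = 0 := by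
    refine le_antisymm ?_ (Finset.sum_nonneg hnonneg)
    rw [Finset.sum_add_distrib]
    linarith
  refine ⟨?_, fun k => (Finset.sum_eq_zero_iff_of_nonneg hnonneg).1 hsum k (Finset.mem_univ k)⟩
  have hconj : conjugate (fun X => (f X : EReal)) Z = ((-primalObj E f a : ℝ) : EReal) := by
    rw [EReal.coe_neg, h, dualObj, neg_neg]
  rw [Finset.sum_add_distrib] at hsum
  rw [hconj, ← EReal.coe_add, EReal.coe_eq_coe_iff, primalObj, trInner_sum_dyad]
  linarith

end Conjugate

/-! ### Controllability pencils -/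

lemma rank_eq_card_iff_vecMul {K m n : Type*} [Field K] [Fintype m] [Fintype n]
    {M : Matrix m n K} : M.rank = Fintype.card m ↔ ∀ w, w ᵥ* M = 0 → w = 0 := by
  rw [Matrix.rank_eq_finrank_span_row, eq_comm, ← Set.finrank,
    ← linearIndependent_iff_card_eq_finrank_span, ← Matrix.vecMul_injective_iff]
  exact injective_iff_map_eq_zero M.vecMulLinear

lemma vecMul_pow_of_vecMul_eq_smul {R n : Type*} [CommSemiring R] [Fintype n] [DecidableEq n]
    {A : Matrix n n R} {w : n → R} {c : R} (hw : w ᵥ* A = c • w) (k : ℕ) :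
    w ᵥ* A ^ k = c ^ k • w := by
  induction k with
  | zero => simp
  | succ k ih => rw [pow_succ, ← Matrix.vecMul_vecMul, ih, Matrix.smul_vecMul, hw, smul_smul,
      pow_succ]

lemma isUnit_det_smul_one_sub {K n : Type*} [Field K] [Fintype n] [DecidableEq n]
    {A : Matrix n n K} {z : K} (hz : ¬ Module.End.HasEigenvalue (Matrix.toLin' A) z) :
    IsUnit (z • 1 - A).det := by
  refine isUnit_iff_ne_zero.2 fun h0 => ?_
  obtain ⟨v, hv0, hv⟩ := Matrix.exists_mulVec_eq_zero_iff.2 h0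
  rw [Matrix.sub_mulVec, Matrix.smul_mulVec, Matrix.one_mulVec, sub_eq_zero] at hv
  exact hz (Module.End.hasEigenvalue_of_hasEigenvector
    ⟨Module.End.mem_eigenspace_iff.2 hv.symm, hv0⟩)

section System

variable {s m : ℕ} {A : Matrix (Fin s) (Fin s) ℂ} {B : Matrix (Fin s) (Fin m) ℂ}

lemma vecMul_sysPencil (μ ν : ℂ) (w : Fin s → ℂ) :
    w ᵥ* (μ • sysG s m - ν • sysF A B) =
      Sum.elim (μ • w - ν • w ᵥ* A) (-(ν • w ᵥ* B)) := by
  rw [Matrix.vecMul_sub, Matrix.vecMul_smul, Matrix.vecMul_smul, sysG, sysF,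
    Matrix.vecMul_fromCols, Matrix.vecMul_fromCols, Matrix.vecMul_one, Matrix.vecMul_zero]
  ext (i | i) <;> simp

lemma sysPencil_mulVec (μ ν : ℂ) (v : Fin s → ℂ) (u : Fin m → ℂ) :
    (μ • sysG s m - ν • sysF A B) *ᵥ Sum.elim v u = (μ • 1 - ν • A) *ᵥ v - ν • B *ᵥ u := by
  simp only [sysG, sysF, Matrix.sub_mulVec, Matrix.smul_mulVec, Matrix.fromCols_mulVec_sumElim,
    Matrix.one_mulVec, Matrix.zero_mulVec]
  module

lemma Controllable.eq_zero_of_vecMul_eq (h : Controllable A B) {w : Fin s → ℂ} {z : ℂ}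
    (hA : w ᵥ* A = z • w) (hB : w ᵥ* B = 0) : w = 0 := by
  refine rank_eq_card_iff_vecMul.1 (h.trans (Fintype.card_fin s).symm) w (funext fun j => ?_)
  have hAB : w ᵥ* (A ^ (j.1 : ℕ) * B) = 0 := by
    rw [← Matrix.vecMul_vecMul, vecMul_pow_of_vecMul_eq_smul hA, Matrix.smul_vecMul, hB, smul_zero]
  exact congrFun hAB j.2

/-- The easy half of the Popov–Belevitch–Hautus test. -/
lemma Controllable.fullRowRank (h : Controllable A B) :
    FullRowRank (sysF A B) (sysG s m) := by
  intro μ ν hμν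
  refine rank_eq_card_iff_vecMul.2 fun w hw => ?_
  rw [vecMul_sysPencil] at hw
  have hA : μ • w - ν • w ᵥ* A = 0 := congrArg (· ∘ Sum.inl) hw
  have hB : -(ν • w ᵥ* B) = 0 := congrArg (· ∘ Sum.inr) hw
  obtain rfl | hν := eq_or_ne ν 0
  · have hμ : μ ≠ 0 := fun hμ => hμν (by rw [hμ])
    rw [zero_smul, sub_zero] at hA
    exact (smul_eq_zero_iff_right hμ).1 hA
  · refine h.eq_zero_of_vecMul_eq (z := ν⁻¹ * μ) ?_
      ((smul_eq_zero_iff_right hν).1 (neg_eq_zero.1 hB))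
    rw [mul_smul, sub_eq_zero.1 hA, inv_smul_smul₀ hν]

lemma mem_curve_smul {Φ Ψ : Herm (Fin 2)} {x : ℂ × ℂ} {c : ℂ} (hc : c ≠ 0)
    (hx : x ∈ curve Φ Ψ) : c • x ∈ curve Φ Ψ := by
  obtain ⟨hx0, hxΦ, hxΨ⟩ := hx
  refine ⟨smul_ne_zero hc hx0, ?_, ?_⟩
  · rw [Prod.smul_fst, Prod.smul_snd, smul_eq_mul, smul_eq_mul, quadForm_smul, hxΦ, mul_zero]
  · rw [Prod.smul_fst, Prod.smul_snd, smul_eq_mul, smul_eq_mul, quadForm_smul]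
    exact mul_nonpos_of_nonneg_of_nonpos (by positivity) hxΨ

lemma popov_posSemidef_iff {N : Herm (Fin s ⊕ Fin m)} {z : ℂ} :
    (popov A B N z).PosSemidef ↔
      ∀ u, 0 ≤ herForm N (Sum.elim ((z • 1 - A)⁻¹ *ᵥ (B *ᵥ u)) u) := by
  have hN : (popov A B N z).IsHermitian := Matrix.isHermitian_conjTranspose_mul_mul _ N.isHermitian
  refine (posSemidef_iff_herForm (Z := ⟨popov A B N z, hN⟩)).trans (forall_congr' fun u => ?_)
  have hu : Matrix.fromRows ((z • 1 - A)⁻¹ * B) 1 *ᵥ u =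
      Sum.elim ((z • 1 - A)⁻¹ *ᵥ (B *ᵥ u)) u := by
    rw [Matrix.fromRows_mulVec, ← Matrix.mulVec_mulVec, Matrix.one_mulVec]
  simp only [herForm, popov, ← hu]
  rw [← Matrix.mulVec_mulVec, ← Matrix.mulVec_mulVec, Matrix.dotProduct_mulVec,
    Matrix.vecMul_conjTranspose, star_star]

lemma toBlocks₂₂_posSemidef_iff {k l : Type*} [Fintype k] [Fintype l] {N : Herm (k ⊕ l)} :
    (N : Matrix (k ⊕ l) (k ⊕ l) ℂ).toBlocks₂₂.PosSemidef ↔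
      ∀ u, 0 ≤ herForm N (Sum.elim 0 u) := by
  have hN : (N : Matrix (k ⊕ l) (k ⊕ l) ℂ).toBlocks₂₂.IsHermitian :=
    N.isHermitian.submatrix Sum.inr
  refine (posSemidef_iff_herForm (Z := ⟨_, hN⟩)).trans (forall_congr' fun u => ?_)
  simp [herForm, dotProduct, Matrix.mulVec, Matrix.toBlocks₂₂]

variable {Φ Ψ : Herm (Fin 2)}

lemma mem_dict_sys_iff (hA : ∀ z : ℂ, (z, 1) ∈ curve Φ Ψ →
      ¬ Module.End.HasEigenvalue (Matrix.toLin' A) z) {v : Fin s → ℂ} {u : Fin m → ℂ} :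
    Sum.elim v u ∈ dict Φ Ψ (sysF A B) (sysG s m) ↔
      (∃ z, (z, 1) ∈ curve Φ Ψ ∧ v = (z • 1 - A)⁻¹ *ᵥ (B *ᵥ u)) ∨
        (1, 0) ∈ curve Φ Ψ ∧ v = 0 := by
  constructor
  · rintro ⟨⟨μ, ν⟩, hx, hker⟩
    rw [sysPencil_mulVec] at hker
    obtain rfl | hν := eq_or_ne ν 0
    · have hμ : μ ≠ 0 := fun hμ => hx.1 (by rw [hμ]; rfl)
      refine .inr ⟨?_, ?_⟩
      · simpa [hμ] using mem_curve_smul (inv_ne_zero hμ) hx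
      · simpa [Matrix.smul_mulVec, hμ] using hker
    · have hz : (ν⁻¹ * μ, (1 : ℂ)) ∈ curve Φ Ψ := by
        simpa [hν] using mem_curve_smul (inv_ne_zero hν) hx
      have hpencil : (ν⁻¹ * μ) • (1 : Matrix (Fin s) (Fin s) ℂ) - A = ν⁻¹ • (μ • 1 - ν • A) := by
        rw [smul_sub, smul_smul, inv_smul_smul₀ hν]
      have hv : ((ν⁻¹ * μ) • 1 - A) *ᵥ v = B *ᵥ u := by
        rw [hpencil, Matrix.smul_mulVec, sub_eq_zero.1 hker, inv_smul_smul₀ hν]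
      refine .inl ⟨ν⁻¹ * μ, hz, ?_⟩
      rw [← hv, Matrix.mulVec_mulVec, Matrix.nonsing_inv_mul _ (isUnit_det_smul_one_sub (hA _ hz)),
        Matrix.one_mulVec]
  · rintro (⟨z, hz, rfl⟩ | ⟨hinf, rfl⟩)
    · refine ⟨_, hz, ?_⟩
      rw [sysPencil_mulVec, one_smul, one_smul, Matrix.mulVec_mulVec,
        Matrix.mul_nonsing_inv _ (isUnit_det_smul_one_sub (hA z hz)), Matrix.one_mulVec, sub_self]
    · refine ⟨_, hinf, ?_⟩
      rw [sysPencil_mulVec, Matrix.mulVec_zero, zero_smul, sub_zero]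

lemma dualFeasible_iff_popovFeasible {q : Type*} [Fintype q] {E : Matrix q (Fin s ⊕ Fin m) ℂ}
    (hA : ∀ z : ℂ, (z, 1) ∈ curve Φ Ψ → ¬ Module.End.HasEigenvalue (Matrix.toLin' A) z)
    {Z : Herm (Fin s ⊕ Fin m)} :
    DualFeasible Φ Ψ (sysF A B) (sysG s m) E Z ↔ PopovFeasible Φ Ψ A B E Z := by
  have hdual : DualFeasible Φ Ψ (sysF A B) (sysG s m) E Z ↔
      ∀ v u, Sum.elim v u ∈ dict Φ Ψ (sysF A B) (sysG s m) →
        0 ≤ herForm (gram E + Z) (Sum.elim v u) := by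
    simp only [DualFeasible, herForm_add, herForm_gram]
    exact ⟨fun h v u => h _, fun h a => Sum.elim_comp_inl_inr a ▸ h (a ∘ Sum.inl) (a ∘ Sum.inr)⟩
  have hcoe : Eᴴ * E + (Z : Matrix (Fin s ⊕ Fin m) (Fin s ⊕ Fin m) ℂ) =
      ((gram E + Z : Herm (Fin s ⊕ Fin m)) : Matrix (Fin s ⊕ Fin m) (Fin s ⊕ Fin m) ℂ) := rfl
  have hpopov : PopovFeasible Φ Ψ A B E Z ↔
      (∀ z, (z, 1) ∈ curve Φ Ψ → ∀ u,
        0 ≤ herForm (gram E + Z) (Sum.elim ((z • 1 - A)⁻¹ *ᵥ (B *ᵥ u)) u)) ∧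
      ((1, 0) ∈ curve Φ Ψ → ∀ u, 0 ≤ herForm (gram E + Z) (Sum.elim 0 u)) := by
    simp only [PopovFeasible, hcoe, popov_posSemidef_iff, toBlocks₂₂_posSemidef_iff]
  simp only [hdual, hpopov, mem_dict_sys_iff hA]
  constructor
  · exact fun h => ⟨fun z hz u => h _ u (.inl ⟨z, hz, rfl⟩), fun hinf u => h 0 u (.inr ⟨hinf, rfl⟩)⟩
  · rintro ⟨hfin, hinf⟩ v u (⟨z, hz, rfl⟩ | ⟨hcurve, rfl⟩)
    exacts [hfin z hz u, hinf hcurve u]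

end System

end

end SymGauge

theorem mainTheorem4
    (Φ Ψ : SymGauge.Herm (Fin 2))
    (hΦ : (Φ : Matrix (Fin 2) (Fin 2) ℂ).det.re < 0)
    (hC : SymGauge.IsOneDimensional Φ Ψ) :
    -- general pencils
    (∀ (p n q : Type) [Fintype p] [Fintype n] [Fintype q]
      (F G : Matrix p n ℂ) (E : Matrix q n ℂ), SymGauge.FullRowRank F G →
      -- the gauge, in semidefinite form
      (∀ X : SymGauge.Herm n,
        (SymGauge.PrimalFeasible Φ Ψ F G X →
          SymGauge.symGauge Φ Ψ F G E X = (((E * (X : Matrix n n ℂ) * Eᴴ).trace.re : ℝ) : EReal)) ∧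
        (¬ SymGauge.PrimalFeasible Φ Ψ F G X → SymGauge.symGauge Φ Ψ F G E X = ⊤)) ∧
      -- the conjugate of the gauge
      (∀ Z : SymGauge.Herm n,
        (SymGauge.conjugate (SymGauge.symGauge Φ Ψ F G E) Z = 0 ↔
          SymGauge.LMIFeasible Φ Ψ F G E Z) ∧
        (SymGauge.LMIFeasible Φ Ψ F G E Z ↔ SymGauge.BoundedOnDict Φ Ψ F G E Z) ∧
        (¬ SymGauge.BoundedOnDict Φ Ψ F G E Z →
          SymGauge.conjugate (SymGauge.symGauge Φ Ψ F G E) Z = ⊤) ∧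
        -- the case of a redundant inequality: the term with `Ψ` can be omitted
        ((∀ μ ν : ℂ, SymGauge.quadForm Φ μ ν = 0 → SymGauge.quadForm Ψ μ ν ≤ 0) →
          (SymGauge.LMIFeasible Φ Ψ F G E Z ↔ SymGauge.LMIFeasible Φ 0 F G E Z))) ∧
      -- the dual problem and complementary slackness
      (∀ f : SymGauge.Herm n → ℝ,
        SymGauge.primalValue Φ Ψ F G E f =
          (⨅ X : SymGauge.Herm n, ((f X : EReal) + SymGauge.symGauge Φ Ψ F G E X)) ∧
        SymGauge.dualValue Φ Ψ F G E f =
          (⨆ (Z : SymGauge.Herm n) (P : SymGauge.Herm p) (Q : SymGauge.Herm p)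
            (_ : SymGauge.IsCertificate Φ Ψ F G E (-Z) P Q), SymGauge.dualObj f Z) ∧
        SymGauge.dualValue Φ Ψ F G E f =
          (⨆ (Z : SymGauge.Herm n) (_ : SymGauge.DualFeasible Φ Ψ F G E Z),
            SymGauge.dualObj f Z) ∧
        SymGauge.dualValue Φ Ψ F G E f ≤ SymGauge.primalValue Φ Ψ F G E f ∧
        (SymGauge.primalValue Φ Ψ F G E f = SymGauge.dualValue Φ Ψ F G E f →
          ∀ (r : ℕ) (a : Fin r → n → ℂ) (Z : SymGauge.Herm n),
            (∀ k, a k ∈ SymGauge.dict Φ Ψ F G) →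
            (SymGauge.primalObj E f a : EReal) = SymGauge.primalValue Φ Ψ F G E f →
            SymGauge.DualFeasible Φ Ψ F G E Z →
            SymGauge.dualObj f Z = SymGauge.dualValue Φ Ψ F G E f →
            (f (∑ k, SymGauge.dyad (a k)) : EReal) +
                SymGauge.conjugate (fun X => (f X : EReal)) Z =
              ((SymGauge.trInner (∑ k, SymGauge.dyad (a k)) Z : ℝ) : EReal) ∧
            ∀ k, SymGauge.normSqE E (a k) + SymGauge.herForm Z (a k) = 0))) ∧
    -- controllability pencils: the generalized Kalman-Yakubovich-Popov lemma
    (∀ (s m : ℕ) (q : Type) [Fintype q]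
      (A : Matrix (Fin s) (Fin s) ℂ) (B : Matrix (Fin s) (Fin m) ℂ)
      (E : Matrix q (Fin s ⊕ Fin m) ℂ),
      SymGauge.Controllable A B →
      (∀ z : ℂ, (z, 1) ∈ SymGauge.curve Φ Ψ →
        ¬ Module.End.HasEigenvalue (Matrix.toLin' A) z) →
      SymGauge.FullRowRank (SymGauge.sysF A B) (SymGauge.sysG s m) ∧
      (∀ Z : SymGauge.Herm (Fin s ⊕ Fin m),
        (SymGauge.LMIFeasible Φ Ψ (SymGauge.sysF A B) (SymGauge.sysG s m) E (-Z) ↔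
          SymGauge.DualFeasible Φ Ψ (SymGauge.sysF A B) (SymGauge.sysG s m) E Z) ∧
        (SymGauge.DualFeasible Φ Ψ (SymGauge.sysF A B) (SymGauge.sysG s m) E Z ↔
          SymGauge.PopovFeasible Φ Ψ A B E Z)) ∧
      (∀ f : SymGauge.Herm (Fin s ⊕ Fin m) → ℝ,
        SymGauge.dualValue Φ Ψ (SymGauge.sysF A B) (SymGauge.sysG s m) E f =
          ⨆ (Z : SymGauge.Herm (Fin s ⊕ Fin m)) (_ : SymGauge.PopovFeasible Φ Ψ A B E Z),
            SymGauge.dualObj f Z)) := by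
  have hdet : (Φ : Matrix (Fin 2) (Fin 2) ℂ).det ≠ 0 := fun h => by simp [h] at hΦ
  refine ⟨fun p n q _ _ _ F G E hrank => ⟨fun X => ⟨fun hX => ?_, ?_⟩,
    fun Z => ⟨?_, ?_, ?_, ?_⟩, fun f => ⟨?_, ?_, ?_, ?_, ?_⟩⟩,
    fun s m q _ A B E hAB hA => ⟨hAB.fullRowRank, fun Z => ⟨?_, ?_⟩, fun f => ?_⟩⟩
  · rw [← SymGauge.trInner_gram]
    exact SymGauge.symGauge_eq hdet hC E hX
  · exact SymGauge.symGauge_eq_top E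
  · exact (SymGauge.conjugate_symGauge_eq_zero_iff hdet hC).trans
      (SymGauge.lmiFeasible_iff_boundedOnDict hdet hC hrank).symm
  · exact SymGauge.lmiFeasible_iff_boundedOnDict hdet hC hrank
  · exact SymGauge.conjugate_symGauge_eq_top
  · exact SymGauge.lmiFeasible_iff_of_redundant hdet hC hrank
  · exact SymGauge.primalValue_eq_iInf hdet hC
  · exact SymGauge.dualValue_eq_iSup_isCertificate hdet hC hrank
  · exact SymGauge.dualValue_eq_iSup_dualFeasible hdet hC
  · exact SymGauge.dualValue_le_primalValue hdet hC
  · exact fun heq r a Z ha hopt hZ hZopt =>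
      hZ.complementary_slackness ha (hopt.trans (heq.trans hZopt.symm))
  · exact SymGauge.lmiFeasible_neg_iff_dualFeasible hdet hC hAB.fullRowRank
  · exact SymGauge.dualFeasible_iff_popovFeasible hA
  · simp only [SymGauge.dualValue_eq_iSup_dualFeasible hdet hC,
      SymGauge.dualFeasible_iff_popovFeasible hA]
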